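/- **Setting.** Consider an episodic Block MDP with horizon $H$, finite latent space $\mathcal Z$, finite action space $\mathcal A$, arbitrary measurable observation space $\mathcal S$, emissions $o_h(\cdot\mid z)$, latent transitions $T_h(\cdot\mid z,a)$, measurable decoders $\psi^\star_h:\mathcal S\to\mathcal Z$ with $o_h(\{s:\psi_h^\star(s)=z\}\mid z)=1$, transitions $P_h^\star(\cdot\mid s,a)=\sum_{z'}T_h(z'\mid\psi_h^\star(s),a)\,o_{h+1}(\cdot\mid z')$, and nonnegative measurable rewards $r_h$ whose sum along any trajectory is at most $1$ ($r_h=0$ for $h\ge H$). Let $d=|\mathcal Z||\mathcal A|$. For every $h$ let $\Phi_h$ be a finite class of one-hot features $\phi(s,a)=e_{(\psi(s),a)}\in\mathbb R^d$ ($\psi:\mathcal S\to\mathcal Z$ measurable), with $\phi_h^\star=e_{(\psi_h^\star(s),a)}\in\Phi_h$ for $h<H$. Fix $h<H$, $n\ge1$, $\delta\in(0,1)$, $\lambda>0$. The dataset $\mathcal D=\{(s_i,a_i,s_i')\}_{i<n}$ is collected adaptively: given the past, $(s_i,a_i)$ has law $q_i$, which may depend on the past, and then $s_i'\sim P_h^\star(\cdot\mid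 s_i,a_i)$; let $\rho=\frac1n\sum_{i<n}q_i$. Let $\mathcal L(\phi,w,f)=\frac1n\sum_{(s,a,s')\in\mathcal D}(w^\top\phi(s,a)-f(s'))^2+\frac\lambda n\|w\|_2^2$. RepLearn with discriminator class $\mathcal F$ and threshold $\ell$ starts from an arbitrary $\phi^0\in\Phi_h$; at iteration $t=0,1,\dots$ it chooses $f^t\in\mathcal F$ maximizing $\max_{\tilde\phi\in\Phi_h}[\min_w\mathcal L(\phi^t,w,f)-\min_{\tilde w}\mathcal L(\tilde\phi,\tilde w,f)]$ over $f\in\mathcal F$; if this maximum is at most $\ell$ it stops and returns $\hat\phi=\phi^t$; otherwise it chooses $\phi^{t+1}\in\Phi_h$ minimizing $\min_{w_0,\dots,w_t}\sum_{i\le t}\mathcal L(\phi,w_i,f^i)$. Write $\hat w_f=\arg\min_w\mathcal L(\hat\phi,w,f)$ and $\mathrm{err}(f)=\mathbb E_{(s,a)\sim\rho}\big[(\hat w_f^\top\hat\phi(s,a)-\mathbb E_{s'\sim P_h^\star(s,a)}f(s'))^2\big]$. Let $\|\mathcal F\|_\gamma$ be the sup-norm $\gamma$-covering number of $\mathcal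 F$ (centers in $\mathcal F$). For $L,\tilde\epsilon>0$ put $\epsilon_1=16\sqrt2\,Ld^{3/2}\tilde\epsilon^{1/2}$ and $\ell=\frac32\epsilon_1+\tilde\epsilon+\frac{2\lambda L^2d}n$. **(1) General discriminators.** Let $\mathcal F$ be a nonempty class of measurable functions $\mathcal S\to[-L,L]$ with $\|\mathcal F\|_{L/2n}<\infty$, and let $$\tilde\epsilon\ \ge\ \frac{56L^2}{n}\log\frac{2(4n)^d|\Phi_h|\,\|\mathcal F\|_{L/2n}}\delta\qquad(\text{for example with equality}),\qquad \frac{2\lambda L^2}n\le\tilde\epsilon .$$ Then with probability at least $1-\delta$, every execution of RepLearn with threshold $\ell$ stops after at most $\max\{1,\sqrt{L^2d/(2\tilde\epsilon)}\}$ iterations, and its output satisfies $\mathrm{err}(f)\le75\,Ld^{3/2}\tilde\epsilon^{1/2}$ for all $f\in\mathcal F$. **(2) The class $\mathcal F_h$.** For $c>0$ let $\mathcal F_h$ be the set of all functions $f(s)=\frac1{|\mathcal A|}\sum_a[\phi(s,a)^\top\theta-\phi'(s,a)^\top\theta']$ with $\phi,\phi'\in\Phi_{h+1}$, $\|\theta\|_\infty,\|\theta'\|_\infty\le1$,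 and of all functions $f(s)=\max_a\big(\frac{r_{h+1}(s,a)+\min\{w^\top\phi(s,a),2\}}{2H+1}+\phi(s,a)^\top w'\big)$ with $\phi\in\Phi_{h+1}$, $\|w\|_\infty\le c$, $\|w'\|_\infty\le1$. For every $c_0>0$ there are constants $C_1,C_2>0$ depending only on $c_0$ such that the following holds. Let $\mathcal F\subseteq\mathcal F_h$ be nonempty with $\|f\|_\infty\le2$ for all $f\in\mathcal F$, let $n\ge2$, let $|\Phi|$ be any integer with $|\Phi|\ge\max(|\Phi_h|,|\Phi_{h+1}|)$, let $\lambda\le c_0\,d\log(n|\Phi|/\delta)$, and $L=2$. Then $\tilde\epsilon_n:=C_1d\log(n|\Phi|/\delta)/n$ satisfies both conditions on $\tilde\epsilon$ in (1), and for every $\tilde\epsilon\le\tilde\epsilon_n$ satisfying these two conditions, with probability at least $1-\delta$ every execution of RepLearn with threshold $\ell$ stops after at most $\max\{1,\sqrt{L^2d/(2\tilde\epsilon)}\}$ iterations, and $$\mathrm{err}(f)\le\zeta_n=C_2\,d^2\sqrt{\frac{\log(n|\Phi|/\delta)}n}\qquad\text{for all }f\in\mathcal F.$$ -/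

import Mathlib

open MeasureTheory ProbabilityTheory
open scoped ENNReal

noncomputable section

/-- An episodic Block MDP with observation space `S`, latent space `Z` and action space `A`.
`emit h z` is the emission distribution at step `h`, `trans h (z, a)` the latent transition from
step `h` to step `h + 1`, and `decoder h` recovers the latent state that emitted an observation.
Rewards are nonnegative, the cumulative reward of a trajectory is at most `1`, and no reward is
paid from step `horizon` on. -/
structure BlockMDP (S Z A : Type*) [MeasurableSpace S] [MeasurableSpace Z] [MeasurableSpace A] where
  horizon : ℕ
  init : Measure S
  init_prob : IsProbabilityMeasure init
  emit : ℕ → Kernel Z S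
  emit_markov : ∀ h, IsMarkovKernel (emit h)
  trans : ℕ → Kernel (Z × A) Z
  trans_markov : ∀ h, IsMarkovKernel (trans h)
  decoder : ℕ → S → Z
  decoder_measurable : ∀ h, Measurable (decoder h)
  emit_decoder : ∀ h z, ∀ᵐ s ∂(emit h z), decoder h s = z
  reward : ℕ → S → A → ℝ
  reward_measurable : ∀ h a, Measurable fun s => reward h s a
  reward_nonneg : ∀ h s a, 0 ≤ reward h s a
  reward_sum_le_one : ∀ (s : ℕ → S) (a : ℕ → A),
    ∑ h ∈ Finset.range horizon, reward h (s h) (a h) ≤ 1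
  reward_eq_zero : ∀ h s a, horizon ≤ h → reward h s a = 0

/-- The transition kernel `P⋆_h(· | s, a) = ∑ z', T_h(z' | ψ⋆_h(s), a) o_{h+1}(· | z')`. -/
def BlockMDP.transition {S Z A : Type*} [MeasurableSpace S] [MeasurableSpace Z]
    [MeasurableSpace A] (M : BlockMDP S Z A) (h : ℕ) : Kernel (S × A) S :=
  (M.emit (h + 1)).comp
    ((M.trans h).comap (fun p : S × A => (M.decoder h p.1, p.2))
      (((M.decoder_measurable h).comp measurable_fst).prodMk measurable_snd))

/-- The one-hot feature map `φ(s, a) = e_{(ψ(s), a)}` of a decoder `ψ`. -/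
def oneHot {S Z A : Type*} (ψ : S → Z) : S → A → (Z × A) → ℝ :=
  fun s a => Set.indicator {(ψ s, a)} (fun _ => 1)

/-- All feature maps of the class are one-hot features of (measurable) candidate decoders. -/
def IsBlockFeatureClass {S Z A : Type*} [MeasurableSpace S] [MeasurableSpace Z]
    (Φ : Finset (S → A → (Z × A) → ℝ)) : Prop :=
  ∀ φ ∈ Φ, ∃ ψ : S → Z, Measurable ψ ∧ φ = oneHot ψ

/-- Linear discriminators
`f(s) = E_{a ∼ U(A)} [φ(s,a)ᵀ θ - φ'(s,a)ᵀ θ']` with `‖θ‖_∞, ‖θ'‖_∞ ≤ 1`. -/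
def discriminators₁ {S A ι : Type*} [Fintype A] [Fintype ι]
    (Φ : Finset (S → A → ι → ℝ)) : Set (S → ℝ) :=
  {f | ∃ φ ∈ Φ, ∃ φ' ∈ Φ, ∃ θ θ' : ι → ℝ, (∀ j, |θ j| ≤ 1) ∧ (∀ j, |θ' j| ≤ 1) ∧
    f = fun s => (Fintype.card A : ℝ)⁻¹ * ∑ a, (φ s a ⬝ᵥ θ - φ' s a ⬝ᵥ θ')}

/-- Value-type discriminators
`f(s) = max_a ((r(s,a) + min (wᵀ φ(s,a)) 2) / (2H+1) + φ(s,a)ᵀ w')`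
with `‖w‖_∞ ≤ c` and `‖w'‖_∞ ≤ 1`. -/
def discriminators₂ {S A ι : Type*} [Fintype A] [Nonempty A] [Fintype ι]
    (Φ : Finset (S → A → ι → ℝ)) (r : S → A → ℝ) (H : ℕ) (c : ℝ) : Set (S → ℝ) :=
  {f | ∃ φ ∈ Φ, ∃ w w' : ι → ℝ, (∀ j, |w j| ≤ c) ∧ (∀ j, |w' j| ≤ 1) ∧
    f = fun s => Finset.univ.sup' Finset.univ_nonempty fun a =>
      (r s a + min (w ⬝ᵥ φ s a) 2) / (2 * (H : ℝ) + 1) + φ s a ⬝ᵥ w'}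

/-- The discriminator class `F_h`, built from the features `Φ_{h+1}` and the reward `r_{h+1}`. -/
def BlockMDP.discriminators {S Z A : Type*} [MeasurableSpace S] [MeasurableSpace Z]
    [MeasurableSpace A] [Fintype Z] [Fintype A] [Nonempty A] (M : BlockMDP S Z A)
    (Φ : ℕ → Finset (S → A → (Z × A) → ℝ)) (c : ℝ) (h : ℕ) : Set (S → ℝ) :=
  discriminators₁ (Φ (h + 1)) ∪ discriminators₂ (Φ (h + 1)) (M.reward (h + 1)) M.horizon c

/-- The sup-norm covering number of a class of functions (`⊤` if there is no finite cover). -/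
def coveringNumber {S : Type*} (F : Set (S → ℝ)) (γ : ℝ) : ℕ∞ :=
  ⨅ C : {C : Finset (S → ℝ) // (∀ g ∈ C, g ∈ F) ∧ ∀ f ∈ F, ∃ g ∈ C, ∀ s, |f s - g s| ≤ γ},
    (C.1.card : ℕ∞)

section RepLearn

variable {S A ι : Type*} [Fintype ι] {n : ℕ}

/-- The ridge-regularized least squares loss
`(1/|D|) ∑_{(s,a,s') ∈ D} (wᵀ φ(s,a) - f(s'))² + (lam/|D|) ‖w‖₂²`. -/
def ridgeLoss (D : Fin n → (S × A) × S) (lam : ℝ) (φ : S → A → ι → ℝ) (w : ι → ℝ)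
    (f : S → ℝ) : ℝ :=
  (n : ℝ)⁻¹ * ∑ i, (w ⬝ᵥ φ (D i).1.1 (D i).1.2 - f (D i).2) ^ 2 +
    lam / (n : ℝ) * ∑ j, w j ^ 2

/-- The objective of the discriminator selection step:
`max_{φ'} [min_w L(φ, w, f) - min_{w'} L(φ', w', f)]`. -/
def discriminatorObjective (D : Fin n → (S × A) × S) (Φ : Finset (S → A → ι → ℝ)) (lam : ℝ)
    (φ : S → A → ι → ℝ) (f : S → ℝ) : ℝ :=
  ⨆ φ' : Φ, ((⨅ w, ridgeLoss D lam φ w f) - ⨅ w', ridgeLoss D lam φ'.1 w' f)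

/-- The objective of the feature selection step at iteration `t`:
`min_{w_0, …, w_t} ∑_{i ≤ t} L(φ, w_i, f_i)`. -/
def featureObjective (D : Fin n → (S × A) × S) (lam : ℝ) (f : ℕ → S → ℝ) (t : ℕ)
    (φ : S → A → ι → ℝ) : ℝ :=
  ⨅ w : Fin (t + 1) → ι → ℝ, ∑ i, ridgeLoss D lam φ (w i) (f i)

/-- Iteration `t` is reached and the stopping test fails there and at all earlier iterations. -/
def Continues (D : Fin n → (S × A) × S) (Φ : Finset (S → A → ι → ℝ)) (lam ell : ℝ)
    (φ : ℕ → S → A → ι → ℝ) (f : ℕ → S → ℝ) (t : ℕ) : Prop :=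
  ∀ s ≤ t, ell < discriminatorObjective D Φ lam (φ s) (f s)

/-- `φ 0, f 0, φ 1, f 1, …` is an execution of RepLearn: `φ 0 ∈ Φ` is arbitrary; as long as the
algorithm has not stopped, `f t` maximizes the discriminator objective over `F`, and `φ (t+1)`
minimizes the feature objective over `Φ`. Entries after the stopping time are irrelevant. -/
structure IsExecution (D : Fin n → (S × A) × S) (Φ : Finset (S → A → ι → ℝ))
    (F : Set (S → ℝ)) (lam ell : ℝ) (φ : ℕ → S → A → ι → ℝ) (f : ℕ → S → ℝ) : Prop where
  init : φ 0 ∈ Φ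
  discriminator : ∀ t, (∀ s < t, Continues D Φ lam ell φ f s) →
    f t ∈ F ∧ ∀ g ∈ F, discriminatorObjective D Φ lam (φ t) g ≤
      discriminatorObjective D Φ lam (φ t) (f t)
  feature : ∀ t, Continues D Φ lam ell φ f t →
    φ (t + 1) ∈ Φ ∧ ∀ φ' ∈ Φ, featureObjective D lam f t (φ (t + 1)) ≤
      featureObjective D lam f t φ'

/-- The execution breaks at iteration `t` (counted from `0`), so it runs `t + 1` iterations and
returns `φ t`. -/
def StopsAt (D : Fin n → (S × A) × S) (Φ : Finset (S → A → ι → ℝ)) (lam ell : ℝ)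
    (φ : ℕ → S → A → ι → ℝ) (f : ℕ → S → ℝ) (t : ℕ) : Prop :=
  (∀ s < t, Continues D Φ lam ell φ f s) ∧ discriminatorObjective D Φ lam (φ t) (f t) ≤ ell

/-- `w` is a ridge regression solution for `f` with features `φ`. -/
def IsRidgeSolution (D : Fin n → (S × A) × S) (lam : ℝ) (φ : S → A → ι → ℝ) (f : S → ℝ)
    (w : ι → ℝ) : Prop :=
  ∀ v, ridgeLoss D lam φ w f ≤ ridgeLoss D lam φ v f

/-- The prediction error `E_{(s,a) ∼ ρ} [(wᵀ φ(s,a) - E_{s' ∼ P(s,a)} f(s'))²]`. -/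
def predictionError [MeasurableSpace S] [MeasurableSpace A] (ρ : Measure (S × A))
    (P : Kernel (S × A) S) (φ : S → A → ι → ℝ) (w : ι → ℝ) (f : S → ℝ) : ℝ :=
  ∫ p, (w ⬝ᵥ φ p.1 p.2 - ∫ s', f s' ∂(P p)) ^ 2 ∂ρ

/-- Transitions `x i = ((s_i, a_i), s'_i)`, `i < n`, collected adaptively: given the past `ℱ i`,
the pair `(s_i, a_i)` is drawn from `q i`, which may depend on the past, and then `s'_i` is drawn
from `P(· | s_i, a_i)`. -/
structure IsAdaptiveSample [MeasurableSpace S] [MeasurableSpace A] {Ω : Type*}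
    {mΩ : MeasurableSpace Ω} (μ : Measure Ω) (P : Kernel (S × A) S) (ℱ : Filtration ℕ mΩ)
    (q : Fin n → Ω → Measure (S × A)) (x : Fin n → Ω → (S × A) × S) : Prop where
  prob : ∀ i ω, IsProbabilityMeasure (q i ω)
  predictable : ∀ i : Fin n, Measurable[ℱ (i : ℕ)] (q i)
  adapted : ∀ i : Fin n, Measurable[ℱ ((i : ℕ) + 1)] (x i)
  conditional_law : ∀ (i : Fin n) (E : Set Ω), MeasurableSet[ℱ (i : ℕ)] E →
    ∀ B : Set ((S × A) × S), MeasurableSet B →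
      μ (E ∩ x i ⁻¹' B) = ∫⁻ ω in E, (q i ω ⊗ₘ P) B ∂μ

/-- The data distribution `ρ = (1/n) ∑ i, q i`. -/
def dataDistribution [MeasurableSpace S] [MeasurableSpace A] {Ω : Type*}
    (q : Fin n → Ω → Measure (S × A)) (ω : Ω) : Measure (S × A) :=
  (n : ℝ≥0∞)⁻¹ • ∑ i, q i ω

/-- With probability at least `1 - δ`, every execution of RepLearn with threshold `ell` stops
after at most `T` iterations (the first stopping test always takes one iteration, so "at most
`max 1 T`"), and the returned features have prediction error at most `ζ` for all `g ∈ F`. -/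
def RepLearnGuarantee [MeasurableSpace S] [MeasurableSpace A] {Ω : Type*}
    {mΩ : MeasurableSpace Ω} (μ : Measure Ω) (P : Kernel (S × A) S)
    (q : Fin n → Ω → Measure (S × A)) (x : Fin n → Ω → (S × A) × S)
    (Φ : Finset (S → A → ι → ℝ)) (F : Set (S → ℝ)) (lam ell δ T ζ : ℝ) : Prop :=
  ∃ G : Set Ω, MeasurableSet G ∧ 1 - δ ≤ μ.real G ∧ ∀ ω ∈ G,
    ∀ (φ : ℕ → S → A → ι → ℝ) (f : ℕ → S → ℝ),
      IsExecution (fun i => x i ω) Φ F lam ell φ f →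
      ∃ t, StopsAt (fun i => x i ω) Φ lam ell φ f t ∧ ((t : ℝ) + 1 ≤ max 1 T) ∧
        ∀ g ∈ F, ∀ w, IsRidgeSolution (fun i => x i ω) lam (φ t) g w →
          predictionError (dataDistribution q ω) P (φ t) w g ≤ ζ

end RepLearn

/-- `56 L² log(2 (4n)^d |Φ| N / δ) / n`. -/
def epsTilde (L δ : ℝ) (n d cardΦ N : ℕ) : ℝ :=
  56 * L ^ 2 * Real.log (2 * (4 * n) ^ d * cardΦ * N / δ) / n

/-- `ε₁ = 16 √2 L d^{3/2} ε^{1/2}`. -/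
def epsOne (L : ℝ) (d : ℕ) (ε : ℝ) : ℝ :=
  16 * √2 * L * (d : ℝ) ^ (3 / 2 : ℝ) * √ε

/-- The termination threshold `ℓ = (3/2) ε₁ + ε + 2 lam L² d / n`. -/
def threshold (L lam : ℝ) (n d : ℕ) (ε : ℝ) : ℝ :=
  3 / 2 * epsOne L d ε + ε + 2 * lam * L ^ 2 * d / n

/-- The iteration bound `√(L² d / (2 ε))`. -/
def iterationBound (L : ℝ) (d : ℕ) (ε : ℝ) : ℝ :=
  √(L ^ 2 * d / (2 * ε))

end

noncomputable section

/-! The transition depends on `s` only through its decoder, so the conditional mean of any `f` at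
the next step is `θ f` evaluated at the latent state and action. It is thus linear in the true
one-hot feature, with coefficients at most `L` for `f ∈ F` (`IsLatentMean`). One-hot predictions are
single coefficients, so truncating weights to `[-L, L]` never hurts, and ridge solutions are bounded
coordinatewise.

Statistics. The excess square loss over the conditional mean has as its conditional expectation the
squared bias, which also controls its conditional second moment. An exponential supermartingale
therefore gives a Bernstein bound valid for adaptive data. A union over two signs, the features, a
grid of weights and a cover of `F` shows that, on one event, all excess losses equal their
prediction errors up to factors `1/2`, `3/2` and an additive `ε / 2`
(`IsAdaptiveSample.exists_uniformlyConcentrated`). The rest is deterministic on this event.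

Termination. If the test fails at iteration `s`, then no weight on `φ s` predicts `f s` with error
at most `ε₁`. Yet `φ s` was fitted to `f 0, …, f (s-1)` in competition with the true feature, so its
total error on these is at most `s * (2 * d * ε)`. Regress `θ (f s)` on the earlier `θ (f i)` with
ridge parameter `κ = T * (2 * d * ε)`, where `T = iterationBound L d ε`, and combine the fitted
weights accordingly. The error for `f s` is then at most `2 * κ` times the squared norm of `θ (f s)`
in the inverse Gram matrix. As `ε₁ = 16 * κ`, that norm is at least `8`, so the Gram determinant
grows ninefold per iteration. The trace bound limits this growth to `exp T`, which rules out `⌊T⌋`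
failed tests when `T ≥ 1`. When `T < 1` the threshold exceeds every possible objective value.

Error. A passed test compares the output with the true feature for the maximizing discriminator,
hence for all of `F`, and concentration turns this into a prediction error bound.

For `F_h` it remains to bound the covering number without reference to `c`: boundedness of `f` makes
very negative coefficients invisible to the maximum over actions
(`exists_bounded_coefficients_of_mem_discriminators₂`). -/

lemma dotProduct_oneHot {S Z A : Type*} [Fintype Z] [Fintype A] (ψ : S → Z) (w : Z × A → ℝ)
    (s : S) (a : A) : w ⬝ᵥ oneHot ψ s a = w (ψ s, a) := by
  classical
  simp [dotProduct, oneHot, Set.indicator_apply]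

/-! ### Truncation to an interval -/

/-- Truncation of a real number to `[-L, L]`. -/
def clip (L x : ℝ) : ℝ := max (-L) (min L x)

lemma abs_clip_le {L : ℝ} (hL : 0 ≤ L) (x : ℝ) : |clip L x| ≤ L := by
  unfold clip
  exact abs_le.2 ⟨le_max_left _ _, max_le (by linarith) (min_le_left _ _)⟩

lemma abs_clip_sub_le {L x y : ℝ} (hy : |y| ≤ L) : |clip L x - y| ≤ |x - y| := by
  obtain ⟨h1, h2⟩ := abs_le.1 hy
  unfold clip
  rcases le_total L x with h | h
  · rw [min_eq_left h, max_eq_right (by linarith), abs_of_nonneg (by linarith),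
      abs_of_nonneg (by linarith)]
    linarith
  · rw [min_eq_right h]
    rcases le_total (-L) x with h' | h'
    · rw [max_eq_right h']
    · rw [max_eq_left h', abs_of_nonpos (by linarith), abs_of_nonpos (by linarith)]
      linarith

lemma clip_sub_sq_le {L x y : ℝ} (hy : |y| ≤ L) : (clip L x - y) ^ 2 ≤ (x - y) ^ 2 :=
  sq_le_sq.2 (abs_clip_sub_le hy)

lemma clip_sq_le {L : ℝ} (hL : 0 ≤ L) (x : ℝ) : clip L x ^ 2 ≤ x ^ 2 := by
  simpa using clip_sub_sq_le (L := L) (x := x) (y := 0) (by simpa)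

lemma clip_sq_lt {L x : ℝ} (hL : 0 ≤ L) (hx : L < |x|) : clip L x ^ 2 < x ^ 2 :=
  sq_lt_sq.2 ((abs_clip_le hL x).trans_lt hx)

/-! ### Ridge regression with one-hot features -/

section Ridge

variable {S Z A : Type*} {n : ℕ} {D : Fin n → (S × A) × S} {lam : ℝ}

lemma ridgeLoss_nonneg {ι : Type*} [Fintype ι] (hlam : 0 ≤ lam) (φ : S → A → ι → ℝ) (w : ι → ℝ)
    (f : S → ℝ) : 0 ≤ ridgeLoss D lam φ w f := by
  unfold ridgeLoss
  positivity

lemma bddBelow_ridgeLoss {ι : Type*} [Fintype ι] (hlam : 0 ≤ lam) (φ : S → A → ι → ℝ)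
    (f : S → ℝ) : BddBelow (Set.range fun w => ridgeLoss D lam φ w f) :=
  ⟨0, by rintro _ ⟨w, rfl⟩; exact ridgeLoss_nonneg hlam φ w f⟩

lemma ridgeLoss_eq_add {ι : Type*} [Fintype ι] (φ : S → A → ι → ℝ) (w : ι → ℝ) (f : S → ℝ) :
    ridgeLoss D lam φ w f = ridgeLoss D 0 φ w f + lam / n * ∑ j, w j ^ 2 := by
  simp [ridgeLoss]

lemma continuous_ridgeLoss {ι : Type*} [Fintype ι] (φ : S → A → ι → ℝ) (f : S → ℝ) :
    Continuous fun w => ridgeLoss D lam φ w f := by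
  unfold ridgeLoss dotProduct
  fun_prop

lemma IsRidgeSolution.iInf_eq {ι : Type*} [Fintype ι] (hlam : 0 ≤ lam) {φ : S → A → ι → ℝ}
    {w : ι → ℝ} {f : S → ℝ} (hw : IsRidgeSolution D lam φ f w) :
    ⨅ v, ridgeLoss D lam φ v f = ridgeLoss D lam φ w f :=
  le_antisymm (ciInf_le (bddBelow_ridgeLoss hlam φ f) w) (le_ciInf hw)

lemma sum_sq_le_of_abs_le {ι : Type*} [Fintype ι] {L : ℝ} {w : ι → ℝ} (hw : ∀ j, |w j| ≤ L) :
    ∑ j, w j ^ 2 ≤ Fintype.card ι * L ^ 2 := by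
  calc ∑ j, w j ^ 2 ≤ ∑ _j : ι, L ^ 2 := Finset.sum_le_sum fun j _ =>
        sq_le_sq' (abs_le.1 (hw j)).1 (abs_le.1 (hw j)).2
    _ = _ := by simp

lemma ridgeLoss_le_add {ι : Type*} [Fintype ι] (hlam : 0 ≤ lam) (φ : S → A → ι → ℝ) {L : ℝ} {w : ι → ℝ}
    (hw : ∀ j, |w j| ≤ L) (f : S → ℝ) :
    ridgeLoss D lam φ w f ≤ ridgeLoss D 0 φ w f + lam / n * (Fintype.card ι * L ^ 2) := by
  rw [ridgeLoss_eq_add]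
  gcongr
  exact sum_sq_le_of_abs_le hw

lemma ridgeLoss_zero_le {ι : Type*} [Fintype ι] (hlam : 0 ≤ lam) (φ : S → A → ι → ℝ) (w : ι → ℝ)
    (f : S → ℝ) : ridgeLoss D 0 φ w f ≤ ridgeLoss D lam φ w f := by
  rw [ridgeLoss_eq_add (lam := lam)]
  exact le_add_of_nonneg_right (by positivity)

variable [Fintype Z] [Fintype A]

/-- A one-hot prediction is a single coefficient, so truncating the weights truncates the
predictions. This moves them closer to targets in `[-L, L]` and shrinks the penalty. -/
lemma ridgeLoss_clip_le (hlam : 0 ≤ lam) {L : ℝ} (hL : 0 ≤ L) (ψ : S → Z) (w : Z × A → ℝ)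
    {f : S → ℝ} (hf : ∀ s, |f s| ≤ L) :
    ridgeLoss D lam (oneHot ψ) (fun j => clip L (w j)) f ≤ ridgeLoss D lam (oneHot ψ) w f := by
  unfold ridgeLoss
  simp only [dotProduct_oneHot]
  refine add_le_add (mul_le_mul_of_nonneg_left ?_ (by positivity))
    (mul_le_mul_of_nonneg_left ?_ (by positivity))
  · exact Finset.sum_le_sum fun i _ => clip_sub_sq_le (hf _)
  · exact Finset.sum_le_sum fun i _ => clip_sq_le hL _

/-- Truncating a coefficient that is too large strictly lowers the penalty. Here `0 < lam` is
essential: a coefficient never met in the data is controlled by the penalty alone. -/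
lemma IsRidgeSolution.abs_le (hn : 0 < n) (hlam : 0 < lam) {L : ℝ} (hL : 0 ≤ L) {ψ : S → Z}
    {w : Z × A → ℝ} {f : S → ℝ} (hf : ∀ s, |f s| ≤ L)
    (hw : IsRidgeSolution D lam (oneHot ψ) f w) (j : Z × A) : |w j| ≤ L := by
  by_contra! hj
  refine absurd (hw fun j => clip L (w j)) (not_le.2 ?_)
  unfold ridgeLoss
  simp only [dotProduct_oneHot]
  refine add_lt_add_of_le_of_lt ?_ ?_
  · exact mul_le_mul_of_nonneg_left (Finset.sum_le_sum fun i _ => clip_sub_sq_le (hf _))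
      (by positivity)
  · have : 0 < lam / n := by positivity
    refine mul_lt_mul_of_pos_left ?_ this
    exact Finset.sum_lt_sum (fun i _ => clip_sq_le hL _) ⟨j, Finset.mem_univ _, clip_sq_lt hL hj⟩

/-- A minimizer over the compact cube is a global one, since truncation maps any weight into the
cube without raising the loss. -/
lemma exists_isRidgeSolution (hlam : 0 ≤ lam) {L : ℝ} (hL : 0 ≤ L) (ψ : S → Z) {f : S → ℝ}
    (hf : ∀ s, |f s| ≤ L) : ∃ w : Z × A → ℝ, IsRidgeSolution D lam (oneHot ψ) f w := by
  have hc : IsCompact (Set.univ.pi fun _ : Z × A => Set.Icc (-L) L) :=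
    isCompact_univ_pi fun _ => isCompact_Icc
  obtain ⟨w, -, hw⟩ := hc.exists_isMinOn ⟨0, fun _ _ => by simp [hL]⟩
    (continuous_ridgeLoss (D := D) (lam := lam) (oneHot ψ) f).continuousOn
  refine ⟨w, fun v => le_trans (hw ?_) (ridgeLoss_clip_le hlam hL ψ v hf)⟩
  intro j _
  exact _root_.abs_le.1 (abs_clip_le hL (v j))

end Ridge

/-! ### Elliptical potential -/

section EllipticalPotential

variable {ι : Type*} [DecidableEq ι]

/-- The regularized Gram matrix `κ I + ∑_{i < s} θ_i θ_iᵀ`. -/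
def regGram (κ : ℝ) (θ : ℕ → ι → ℝ) (s : ℕ) : Matrix ι ι ℝ :=
  κ • (1 : Matrix ι ι ℝ) + ∑ i ∈ Finset.range s, Matrix.vecMulVec (θ i) (θ i)

lemma regGram_succ (κ : ℝ) (θ : ℕ → ι → ℝ) (s : ℕ) :
    regGram κ θ (s + 1) = regGram κ θ s + Matrix.vecMulVec (θ s) (θ s) := by
  simp [regGram, Finset.sum_range_succ, add_assoc]

variable [Fintype ι]

lemma Matrix.det_add_vecMulVec {A : Matrix ι ι ℝ} (hA : IsUnit A.det) (u v : ι → ℝ) :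
    (A + Matrix.vecMulVec u v).det = A.det * (1 + v ⬝ᵥ A⁻¹.mulVec u) := by
  have h := Matrix.det_add_replicateCol_mul_replicateRow (ι := Unit) hA u v
  rw [← Matrix.vecMulVec_eq] at h
  rw [h]
  congr 1
  simp [Matrix.det_unique, ← Matrix.replicateCol_mulVec, ← Matrix.mulVec_mulVec, Matrix.mulVec,
    Matrix.replicateRow_apply]

/-- The arithmetic-geometric mean inequality for the eigenvalues. -/
lemma Matrix.PosSemidef.det_le_trace_div_pow [Nonempty ι] {A : Matrix ι ι ℝ} (hA : A.PosSemidef) :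
    A.det ≤ (A.trace / Fintype.card ι) ^ Fintype.card ι := by
  rw [hA.isHermitian.det_eq_prod_eigenvalues, hA.isHermitian.trace_eq_sum_eigenvalues]
  simp only [RCLike.ofReal_real_eq_id, id_eq]
  have hc : (0 : ℝ) < Fintype.card ι := by exact_mod_cast Fintype.card_pos
  have h := Real.geom_mean_le_arith_mean Finset.univ (fun _ : ι => (1 : ℝ))
    hA.isHermitian.eigenvalues (by simp) (by simpa using hc) (fun i _ => hA.eigenvalues_nonneg i)
  simp only [Real.rpow_one, Finset.sum_const, Finset.card_univ, nsmul_eq_mul, mul_one,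
    one_mul] at h
  have hp : 0 ≤ ∏ i, hA.isHermitian.eigenvalues i :=
    Finset.prod_nonneg fun i _ => hA.eigenvalues_nonneg i
  calc ∏ i, hA.isHermitian.eigenvalues i
      = ((∏ i, hA.isHermitian.eigenvalues i) ^ (Fintype.card ι : ℝ)⁻¹) ^ Fintype.card ι := by
        rw [Real.rpow_inv_natCast_pow hp Fintype.card_ne_zero]
    _ ≤ _ := by gcongr

lemma regGram_posDef {κ : ℝ} (hκ : 0 < κ) (θ : ℕ → ι → ℝ) (s : ℕ) :
    (regGram κ θ s).PosDef := by
  induction s with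
  | zero => simpa [regGram] using Matrix.PosDef.one.smul hκ
  | succ s ih =>
    rw [regGram_succ]
    exact ih.add_posSemidef (by simpa using Matrix.posSemidef_vecMulVec_self_star (θ s))

lemma regGram_mulVec (κ : ℝ) (θ : ℕ → ι → ℝ) (s : ℕ) (g : ι → ℝ) (j : ι) :
    (regGram κ θ s).mulVec g j = κ * g j + ∑ i ∈ Finset.range s, (θ i ⬝ᵥ g) * θ i j := by
  simp [regGram, Matrix.add_mulVec, Matrix.sum_mulVec, Matrix.smul_mulVec,
    Matrix.vecMulVec_mulVec, mul_comm]

lemma regGram_trace_le [Nonempty ι] {κ L : ℝ} {θ : ℕ → ι → ℝ} {m : ℕ}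
    (hθ : ∀ s < m, ∀ j, |θ s j| ≤ L) : (regGram κ θ m).trace / Fintype.card ι ≤ κ + m * L ^ 2 := by
  have hc : (0 : ℝ) < Fintype.card ι := by exact_mod_cast Fintype.card_pos
  have h : ∀ s < m, Matrix.trace (Matrix.vecMulVec (θ s) (θ s)) ≤ Fintype.card ι * L ^ 2 := by
    intro s hs
    rw [Matrix.trace_vecMulVec, dotProduct]
    calc ∑ j, θ s j * θ s j ≤ ∑ _j : ι, L ^ 2 := by
          gcongr with j
          rw [← sq]
          exact sq_le_sq' (abs_le.1 (hθ s hs j)).1 (abs_le.1 (hθ s hs j)).2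
      _ = _ := by simp
  rw [div_le_iff₀ hc, regGram, Matrix.trace_add, Matrix.trace_smul, Matrix.trace_one,
    Matrix.trace_sum, smul_eq_mul]
  calc κ * Fintype.card ι + ∑ i ∈ Finset.range m, Matrix.trace (Matrix.vecMulVec (θ i) (θ i))
      ≤ κ * Fintype.card ι + ∑ i ∈ Finset.range m, Fintype.card ι * L ^ 2 := by
        gcongr with i hi
        exact h i (Finset.mem_range.1 hi)
    _ = _ := by simp; ring

/-- Elliptical potential: if each new vector has squared norm at least `a` in the inverse of the
Gram matrix of its predecessors, there are few vectors. -/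
lemma elliptical_potential [Nonempty ι] {κ L a : ℝ} (hκ : 0 < κ) (ha : 0 ≤ a) {θ : ℕ → ι → ℝ}
    {m : ℕ} (hθ : ∀ s < m, ∀ j, |θ s j| ≤ L)
    (h : ∀ s < m, ∀ g : ι → ℝ,
      (∀ j, θ s j = κ * g j + ∑ i ∈ Finset.range s, (θ i ⬝ᵥ g) * θ i j) → a ≤ θ s ⬝ᵥ g) :
    (1 + a) ^ m ≤ (1 + m * L ^ 2 / κ) ^ Fintype.card ι := by
  have key : ∀ s ≤ m, κ ^ Fintype.card ι * (1 + a) ^ s ≤ (regGram κ θ s).det := by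
    intro s
    induction s with
    | zero => simp [regGram]
    | succ s ih =>
      intro hs
      have hpd := regGram_posDef hκ θ s
      have hu : IsUnit (regGram κ θ s).det := hpd.det_pos.ne'.isUnit
      rw [regGram_succ, Matrix.det_add_vecMulVec hu, pow_succ, ← mul_assoc]
      have := ih (by omega)
      -- The witness is `g = G⁻¹ θ_s` for the current Gram matrix `G`, so `θ s ⬝ᵥ g` is exactly the
      -- factor by which the rank-one update increases the determinant beyond `1`.
      have h2 := h s (by omega) ((regGram κ θ s)⁻¹.mulVec (θ s)) (by
        intro j
        rw [← regGram_mulVec, Matrix.mulVec_mulVec, Matrix.mul_nonsing_inv _ hu,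
          Matrix.one_mulVec])
      have := hpd.det_pos
      gcongr
  have h1 := (key m le_rfl).trans (regGram_posDef hκ θ m).posSemidef.det_le_trace_div_pow
  have h0 : 0 ≤ (regGram κ θ m).trace / Fintype.card ι :=
    div_nonneg (regGram_posDef hκ θ m).posSemidef.trace_nonneg (by positivity)
  have h2 := h1.trans (pow_le_pow_left₀ h0 (regGram_trace_le hθ) _)
  rw [show κ + m * L ^ 2 = κ * (1 + m * L ^ 2 / κ) by field_simp, mul_pow] at h2
  exact le_of_mul_le_mul_left h2 (by positivity)

end EllipticalPotential

/-! ### Consequences of concentration for one iteration -/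

section Execution

variable {S Z A : Type*} [MeasurableSpace S]
  [MeasurableSpace Z] [MeasurableSpace A]

lemma measurable_latent {ψ : S → Z} (hψ : Measurable ψ) :
    Measurable fun p : S × A => (ψ p.1, p.2) :=
  (hψ.comp measurable_fst).prodMk measurable_snd

/-- The conditional means of the functions in `F` under `P` are `θ f (ψ s, a)`, with coefficients
bounded by `L`. -/
structure IsLatentMean (P : Kernel (S × A) S) (ψ : S → Z) (θ : (S → ℝ) → Z × A → ℝ)
    (F : Set (S → ℝ)) (L : ℝ) : Prop where
  measurable : Measurable ψ
  integral_eq : ∀ f p, ∫ s', f s' ∂(P p) = θ f (ψ p.1, p.2)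
  abs_le : ∀ f ∈ F, ∀ j, |θ f j| ≤ L

variable {P : Kernel (S × A) S} {ψ' : S → Z} {θ : (S → ℝ) → Z × A → ℝ} {F : Set (S → ℝ)} {L : ℝ}
  {ρ : Measure (S × A)}

lemma predictionError_nonneg {ι : Type*} [Fintype ι] (φ : S → A → ι → ℝ) (w : ι → ℝ)
    (f : S → ℝ) : 0 ≤ predictionError ρ P φ w f :=
  integral_nonneg fun _ => sq_nonneg _

variable [Fintype Z] [Fintype A]

lemma IsLatentMean.predictionError_eq (h : IsLatentMean P ψ' θ F L) (ψ : S → Z) (w : Z × A → ℝ)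
    (f : S → ℝ) : predictionError ρ P (oneHot ψ) w f =
      ∫ p, (w (ψ p.1, p.2) - θ f (ψ' p.1, p.2)) ^ 2 ∂ρ := by
  simp only [predictionError, dotProduct_oneHot, h.integral_eq]

/-- On the sample `D`, the excess losses of all bounded predictors agree with their prediction
errors up to a factor `1 ± 1/2` and an additive `ε`. -/
def UniformlyConcentrated {n : ℕ} (D : Fin n → (S × A) × S) (ρ : Measure (S × A))
    (P : Kernel (S × A) S) (Φ : Finset (S → A → (Z × A) → ℝ)) (ψ' : S → Z)
    (θ : (S → ℝ) → Z × A → ℝ) (F : Set (S → ℝ)) (L ε : ℝ) : Prop :=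
  ∀ φ ∈ Φ, ∀ w : Z × A → ℝ, (∀ j, |w j| ≤ L) → ∀ f ∈ F,
    1 / 2 * predictionError ρ P φ w f ≤
      ridgeLoss D 0 φ w f - ridgeLoss D 0 (oneHot ψ') (θ f) f + ε ∧
    ridgeLoss D 0 φ w f - ridgeLoss D 0 (oneHot ψ') (θ f) f ≤
      3 / 2 * predictionError ρ P φ w f + ε

variable {n : ℕ} {D : Fin n → (S × A) × S} {Φ : Finset (S → A → (Z × A) → ℝ)} {ε lam ell : ℝ}

/-- A failed test means that some competitor beats `φ` by more than `ell`. No competitor can beat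
the conditional mean by more than `ε`, so even the loss of `w` must be far above it. -/
lemma UniformlyConcentrated.lt_of_lt_discriminatorObjective
    (hU : UniformlyConcentrated D ρ P Φ ψ' θ F L ε) (hΦ : IsBlockFeatureClass Φ) (hn : 0 < n)
    (hlam : 0 < lam) (hL : 0 ≤ L) {f : S → ℝ} (hf : f ∈ F) (hfL : ∀ s, |f s| ≤ L)
    {φ : S → A → (Z × A) → ℝ} (hφ : φ ∈ Φ) (h : ell < discriminatorObjective D Φ lam φ f)
    {w : Z × A → ℝ} (hw : ∀ j, |w j| ≤ L) :
    ell < 3 / 2 * predictionError ρ P φ w f + 2 * ε +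
      lam / n * (Fintype.card (Z × A) * L ^ 2) := by
  have : Nonempty Φ := ⟨⟨φ, hφ⟩⟩
  obtain ⟨⟨φ', hφ'⟩, h⟩ := exists_lt_of_lt_ciSup h
  obtain ⟨ψ, -, rfl⟩ := hΦ φ' hφ'
  obtain ⟨v, hv⟩ := exists_isRidgeSolution (D := D) hlam.le hL ψ hfL
  simp only [hv.iInf_eq hlam.le] at h
  have h1 := ciInf_le (bddBelow_ridgeLoss (D := D) hlam.le φ f) w
  have h2 := ridgeLoss_le_add (D := D) hlam.le φ hw f
  have h3 := (hU φ hφ w hw f hf).2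
  have h4 := (hU _ hφ' v (hv.abs_le hn hlam hL hfL) f hf).1
  have h5 := predictionError_nonneg (ρ := ρ) (P := P) (oneHot (A := A) ψ) v f
  have h6 := ridgeLoss_zero_le (D := D) hlam.le (oneHot ψ) v f
  linarith

/-- The selected feature does at least as well as the true feature with weights `θ (f i)`, whose
excess loss is zero. Only the concentration error and the penalty remain, once per discriminator. -/
lemma UniformlyConcentrated.sum_predictionError_le
    (hU : UniformlyConcentrated D ρ P Φ ψ' θ F L ε) (hΦ : IsBlockFeatureClass Φ)
    (hreal : oneHot ψ' ∈ Φ) (hθ : ∀ f ∈ F, ∀ j, |θ f j| ≤ L) (hn : 0 < n)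
    (hlam : 0 < lam) (hL : 0 ≤ L) {f : ℕ → S → ℝ} {t : ℕ} (hf : ∀ i ≤ t, f i ∈ F)
    (hfL : ∀ i ≤ t, ∀ s, |f i s| ≤ L) {φ : S → A → (Z × A) → ℝ} (hφ : φ ∈ Φ)
    (h : ∀ φ' ∈ Φ, featureObjective D lam f t φ ≤ featureObjective D lam f t φ')
    {w : ℕ → Z × A → ℝ} (hw : ∀ i ≤ t, IsRidgeSolution D lam φ (f i) (w i)) :
    ∑ i ∈ Finset.range (t + 1), predictionError ρ P φ (w i) (f i) ≤
      (t + 1 : ℕ) * (2 * ε + 2 * (lam / n * (Fintype.card (Z × A) * L ^ 2))) := by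
  obtain ⟨ψ, -, rfl⟩ := hΦ φ hφ
  have h1 : ∑ i : Fin (t + 1), ridgeLoss D lam (oneHot ψ) (w i) (f i) ≤
      featureObjective D lam f t (oneHot ψ) :=
    le_ciInf fun v => Finset.sum_le_sum fun i _ => hw i (by omega) (v i)
  have h2 : featureObjective D lam f t (oneHot ψ') ≤
      ∑ i : Fin (t + 1), ridgeLoss D lam (oneHot ψ') (θ (f i)) (f i) := by
    refine ciInf_le (f := fun v : Fin (t + 1) → Z × A → ℝ =>
      ∑ i, ridgeLoss D lam (oneHot ψ') (v i) (f i)) ⟨0, ?_⟩ fun i => θ (f i)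
    rintro _ ⟨v, rfl⟩
    exact Finset.sum_nonneg fun i _ => ridgeLoss_nonneg hlam.le _ _ _
  have h3 := (h1.trans (h _ hreal)).trans h2
  rw [Fin.sum_univ_eq_sum_range (fun i => ridgeLoss D lam (oneHot ψ) (w i) (f i)),
    Fin.sum_univ_eq_sum_range (fun i => ridgeLoss D lam (oneHot ψ') (θ (f i)) (f i)),
    ← sub_nonneg, ← Finset.sum_sub_distrib] at h3
  calc ∑ i ∈ Finset.range (t + 1), predictionError ρ P (oneHot ψ) (w i) (f i)
      ≤ ∑ i ∈ Finset.range (t + 1), ((2 * ε + 2 * (lam / n * (Fintype.card (Z × A) * L ^ 2))) -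
          2 * (ridgeLoss D lam (oneHot ψ') (θ (f i)) (f i) -
            ridgeLoss D lam (oneHot ψ) (w i) (f i))) := by
        refine Finset.sum_le_sum fun i hi => ?_
        have hi : i ≤ t := by simpa [Nat.lt_succ_iff] using hi
        have h4 := (hU _ hφ (w i) ((hw i hi).abs_le hn hlam hL (hfL i hi)) (f i) (hf i hi)).1
        have h5 := ridgeLoss_zero_le (D := D) hlam.le (oneHot ψ) (w i) (f i)
        have h6 := ridgeLoss_le_add (D := D) hlam.le (oneHot ψ') (hθ _ (hf i hi)) (f i)
        linarith
    _ ≤ _ := by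
        rw [Finset.sum_sub_distrib, ← Finset.mul_sum]
        simp only [Finset.sum_const, Finset.card_range, nsmul_eq_mul]
        linarith

variable [MeasurableSingletonClass Z] [MeasurableSingletonClass A]

/-- Such functions factor through the finite set of pairs of latent state-action pairs. -/
lemma integrable_latent₂ {ψ ψ' : S → Z} (hψ : Measurable ψ) (hψ' : Measurable ψ')
    (ρ : Measure (S × A)) [IsFiniteMeasure ρ] (G : Z × A → Z × A → ℝ) :
    Integrable (fun p : S × A => G (ψ p.1, p.2) (ψ' p.1, p.2)) ρ := by
  have hm : Measurable fun p : S × A => ((ψ p.1, p.2), (ψ' p.1, p.2)) :=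
    (measurable_latent hψ).prodMk (measurable_latent hψ')
  have hG : Integrable (fun x : (Z × A) × (Z × A) => G x.1 x.2)
      (ρ.map fun p => ((ψ p.1, p.2), (ψ' p.1, p.2))) := Integrable.of_finite
  exact hG.comp_measurable hm

lemma IsLatentMean.predictionError_clip_le [IsFiniteMeasure ρ] (h : IsLatentMean P ψ' θ F L)
    {ψ : S → Z} (hψ : Measurable ψ) (w : Z × A → ℝ) {f : S → ℝ} (hf : f ∈ F) :
    predictionError ρ P (oneHot ψ) (fun j => clip L (w j)) f ≤
      predictionError ρ P (oneHot ψ) w f := by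
  rw [h.predictionError_eq, h.predictionError_eq]
  refine integral_mono (integrable_latent₂ hψ h.measurable ρ fun i j => (clip L (w i) - θ f j) ^ 2)
    (integrable_latent₂ hψ h.measurable ρ fun i j => (w i - θ f j) ^ 2) fun p => ?_
  exact clip_sub_sq_le (h.abs_le f hf _)

lemma IsLatentMean.predictionError_le [IsProbabilityMeasure ρ] (h : IsLatentMean P ψ' θ F L)
    {ψ : S → Z} (hψ : Measurable ψ) {w : Z × A → ℝ} (hw : ∀ j, |w j| ≤ L) {f : S → ℝ}
    (hf : f ∈ F) : predictionError ρ P (oneHot ψ) w f ≤ 4 * L ^ 2 := by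
  rw [h.predictionError_eq]
  calc ∫ p, (w (ψ p.1, p.2) - θ f (ψ' p.1, p.2)) ^ 2 ∂ρ ≤ ∫ _p, 4 * L ^ 2 ∂ρ := by
        refine integral_mono (integrable_latent₂ hψ h.measurable ρ fun i j => (w i - θ f j) ^ 2)
          (integrable_const _) fun p => ?_
        obtain ⟨h1, h2⟩ := _root_.abs_le.1 (hw (ψ p.1, p.2))
        obtain ⟨h3, h4⟩ := _root_.abs_le.1 (h.abs_le f hf (ψ' p.1, p.2))
        have : (w (ψ p.1, p.2) - θ f (ψ' p.1, p.2)) ^ 2 ≤ (2 * L) ^ 2 :=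
          sq_le_sq' (by linarith) (by linarith)
        simp only
        linarith
    _ = 4 * L ^ 2 := by simp

/-- If `θ (f s)` is reproduced by the `θ (f i)`, `i < s`, up to a ridge residual, then the
corresponding combination of predictors for the `f i` predicts `f s`. -/
lemma IsLatentMean.predictionError_combination_le [IsProbabilityMeasure ρ]
    (h : IsLatentMean P ψ' θ F L) {ψ : S → Z} (hψ : Measurable ψ) {κ : ℝ} (hκ : 0 ≤ κ)
    (f : ℕ → S → ℝ) (w : ℕ → Z × A → ℝ) (s : ℕ) (g : Z × A → ℝ)
    (hg : ∀ j, θ (f s) j = κ * g j + ∑ i ∈ Finset.range s, (θ (f i) ⬝ᵥ g) * θ (f i) j) :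
    0 ≤ θ (f s) ⬝ᵥ g ∧
    predictionError ρ P (oneHot ψ) (fun j => ∑ i ∈ Finset.range s, (θ (f i) ⬝ᵥ g) * w i j) (f s) ≤
      (θ (f s) ⬝ᵥ g) *
        (∑ i ∈ Finset.range s, predictionError ρ P (oneHot ψ) (w i) (f i) + κ) := by
  -- Pairing the ridge identity with `g` splits `θ (f s) ⬝ᵥ g` into the penalty and the squared
  -- combination coefficients.
  have hu : θ (f s) ⬝ᵥ g = κ * ∑ j, g j ^ 2 + ∑ i ∈ Finset.range s, (θ (f i) ⬝ᵥ g) ^ 2 := by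
    calc θ (f s) ⬝ᵥ g = ∑ j, (κ * g j + ∑ i ∈ Finset.range s, (θ (f i) ⬝ᵥ g) * θ (f i) j) * g j :=
          Finset.sum_congr rfl fun j _ => by rw [hg j]
      _ = κ * ∑ j, g j ^ 2 + ∑ i ∈ Finset.range s, (θ (f i) ⬝ᵥ g) * (θ (f i) ⬝ᵥ g) := by
          simp only [add_mul, Finset.sum_add_distrib, Finset.sum_mul, Finset.mul_sum]
          rw [Finset.sum_comm (s := Finset.univ)]
          congr 1
          · exact Finset.sum_congr rfl fun j _ => by ring
          · refine Finset.sum_congr rfl fun i _ => ?_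
            conv_rhs => rw [dotProduct, Finset.mul_sum]
            exact Finset.sum_congr rfl fun j _ => by rw [dotProduct]; ring
      _ = _ := by simp only [sq]
  have hu0 : 0 ≤ θ (f s) ⬝ᵥ g := by rw [hu]; positivity
  refine ⟨hu0, ?_⟩
  simp only [h.predictionError_eq]
  rw [← integral_finsetSum _ fun i _ => integrable_latent₂ hψ h.measurable ρ
    fun k j => (w i k - θ (f i) j) ^ 2]
  have hconst : κ = ∫ _p, κ ∂ρ := by simp
  have hint : Integrable (fun p : S × A => ∑ i ∈ Finset.range s,
      (w i (ψ p.1, p.2) - θ (f i) (ψ' p.1, p.2)) ^ 2) ρ :=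
    integrable_latent₂ hψ h.measurable ρ fun k j =>
      ∑ i ∈ Finset.range s, (w i k - θ (f i) j) ^ 2
  conv_rhs => rw [hconst, ← integral_add hint (integrable_const _), ← integral_const_mul]
  refine integral_mono (integrable_latent₂ hψ h.measurable ρ fun k j =>
      (∑ i ∈ Finset.range s, (θ (f i) ⬝ᵥ g) * w i k - θ (f s) j) ^ 2)
    ((hint.add (integrable_const _)).const_mul _) fun p => ?_
  simp only
  generalize (ψ p.1, p.2) = k
  generalize (ψ' p.1, p.2) = l
  have h1 : ∑ i ∈ Finset.range s, (θ (f i) ⬝ᵥ g) * w i k - θ (f s) l =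
      ∑ i ∈ Finset.range s, (θ (f i) ⬝ᵥ g) * (w i k - θ (f i) l) - κ * g l := by
    rw [hg l]
    simp only [mul_sub, Finset.sum_sub_distrib]
    ring
  have h2 := Finset.sum_mul_sq_le_sq_mul_sq (Finset.range s) (fun i => θ (f i) ⬝ᵥ g)
    (fun i => w i k - θ (f i) l)
  have h3 : g l ^ 2 ≤ ∑ j, g j ^ 2 :=
    Finset.single_le_sum (f := fun j => g j ^ 2) (fun j _ => sq_nonneg _) (Finset.mem_univ l)
  rw [h1]
  set x := ∑ i ∈ Finset.range s, (θ (f i) ⬝ᵥ g) * (w i k - θ (f i) l)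
  set a := ∑ i ∈ Finset.range s, (θ (f i) ⬝ᵥ g) ^ 2
  set b := ∑ i ∈ Finset.range s, (w i k - θ (f i) l) ^ 2
  have ha : 0 ≤ a := Finset.sum_nonneg fun _ _ => sq_nonneg _
  have hb : 0 ≤ b := Finset.sum_nonneg fun _ _ => sq_nonneg _
  -- Cauchy-Schwarz for the coefficients extended by `√κ * g l` and the residuals extended by `-√κ`,
  -- written without square roots.
  have h4 : (x - κ * g l) ^ 2 ≤ (a + κ * g l ^ 2) * (b + κ) := by
    have h5 : -(2 * x * (κ * g l)) ≤ a * κ + κ * g l ^ 2 * b := by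
      have h6 : (2 * x * (κ * g l)) ^ 2 ≤ (a * κ + κ * g l ^ 2 * b) ^ 2 := by
        have : 0 ≤ (a * κ - κ * g l ^ 2 * b) ^ 2 := sq_nonneg _
        have h7 : x ^ 2 * (4 * (κ * g l) ^ 2) ≤ a * b * (4 * (κ * g l) ^ 2) := by gcongr
        nlinarith
      have := abs_le_of_sq_le_sq' h6 (by positivity)
      linarith [this.1]
    nlinarith
  refine h4.trans ?_
  rw [hu]
  have : κ * g l ^ 2 ≤ κ * ∑ j, g j ^ 2 := by gcongr
  exact mul_le_mul_of_nonneg_right (by linarith) (by positivity)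

end Execution

/-! ### Numerical relations between the constants -/

section Constants

variable {L ε : ℝ} {d : ℕ}

lemma rpow_three_halves_eq {x : ℝ} (hx : 0 ≤ x) : x ^ (3 / 2 : ℝ) = x * √x := by
  rw [show (3 / 2 : ℝ) = 1 + 1 / 2 by norm_num, Real.rpow_add_of_nonneg hx (by norm_num)
    (by norm_num), Real.rpow_one, Real.sqrt_eq_rpow]

/-- This explains the constant in `ε₁`: it is `16 * κ` for the ridge parameter `κ = T * (2 * d * ε)`
of the termination argument. -/
lemma epsOne_eq (hL : 0 < L) (hε : 0 < ε) :
    epsOne L d ε = 16 * (iterationBound L d ε * (2 * d * ε)) := by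
  rw [epsOne, iterationBound, rpow_three_halves_eq (by positivity), Real.sqrt_div (by positivity),
    Real.sqrt_mul (by positivity), Real.sqrt_mul (by positivity), Real.sqrt_sq hL.le]
  have h2 : √2 * √2 = 2 := Real.mul_self_sqrt (by norm_num)
  have he : √ε * √ε = ε := Real.mul_self_sqrt hε.le
  have h2' : √2 ≠ 0 := by positivity
  have he' : √ε ≠ 0 := by positivity
  field_simp
  linear_combination d * √d * √ε ^ 2 * h2 + 2 * d * √d * he

lemma iterationBound_sq (hL : 0 < L) (hε : 0 < ε) :
    iterationBound L d ε ^ 2 * (2 * ε) = L ^ 2 * d := by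
  rw [iterationBound, Real.sq_sqrt (by positivity)]
  field_simp

lemma one_add_sq_le_exp {z : ℝ} (hz : 0 ≤ z) : 1 + z ^ 2 ≤ Real.exp z := by
  have h := Real.sum_le_exp_of_nonneg hz 4
  simp [Finset.sum_range_succ, Nat.factorial] at h
  -- The claim reduces to `z² - 3z + 6 ≥ 0`, and this polynomial is `(z - 3/2)² + 15/4`.
  nlinarith [mul_nonneg hz (sq_nonneg (z - 3 / 2))]

/-- The iteration bound `T` satisfies `L² / (2dε) = (T / d)²`, so `1 + z² ≤ exp z` at `z = T / d`
removes the usual logarithm from the potential argument. -/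
lemma one_add_pow_le_exp_iterationBound (hL : 0 < L) (hε : 0 < ε) (hd : 0 < d) :
    (1 + L ^ 2 / (2 * d * ε)) ^ d ≤ Real.exp (iterationBound L d ε) := by
  have hd' : (0 : ℝ) < d := by exact_mod_cast hd
  have h1 : L ^ 2 / (2 * d * ε) = (iterationBound L d ε / d) ^ 2 := by
    have := iterationBound_sq (d := d) hL hε
    rw [div_pow, div_eq_div_iff (by positivity) (by positivity)]
    linear_combination -d * this
  have h0 : 0 ≤ iterationBound L d ε := Real.sqrt_nonneg _
  rw [h1]
  calc (1 + (iterationBound L d ε / d) ^ 2) ^ d ≤ Real.exp (iterationBound L d ε / d) ^ d := by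
        gcongr
        exact one_add_sq_le_exp (by positivity)
    _ = Real.exp (iterationBound L d ε) := by
        rw [← Real.exp_nat_mul]
        congr 1
        field_simp

/-- The error at termination is dominated by the term `ε₁`. -/
lemma termination_error_le (hL : 0 < L) (hε : 0 < ε) (hd : 0 < d) {x : ℝ}
    (h1 : x ≤ 4 * L ^ 2) (h2 : x ≤ 3 * epsOne L d ε + 3 * ε + 3 * d * ε) :
    x ≤ 75 * L * (d : ℝ) ^ (3 / 2 : ℝ) * √ε := by
  have hd' : (1 : ℝ) ≤ d := by exact_mod_cast hd
  have hsd : 1 ≤ √(d : ℝ) := Real.one_le_sqrt.2 hd'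
  rw [epsOne, rpow_three_halves_eq (by positivity)] at h2
  rw [rpow_three_halves_eq (by positivity)]
  have hs2 : √2 ≤ 1.415 := Real.sqrt_le_iff.2 (by norm_num)
  have he : √ε * √ε = ε := Real.mul_self_sqrt hε.le
  have he0 : 0 < √ε := Real.sqrt_pos.2 hε
  have hdd : (1 : ℝ) ≤ d * √d := by nlinarith
  -- For `√ε ≤ L` the lower order terms cost at most `6` on top of `48 * √2 < 68`. Otherwise the
  -- trivial bound `4 * L ^ 2` suffices.
  rcases le_total (√ε) L with h | h
  · have h3 : ε ≤ L * √ε := by nlinarith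
    have h4 : 3 * ε + 3 * d * ε ≤ 6 * (L * (d * √d) * √ε) := by
      have : ε * (d * 1) ≤ (L * √ε) * (d * √d) := by gcongr
      nlinarith
    have h5 : √2 * (L * (d * √d) * √ε) ≤ 1.415 * (L * (d * √d) * √ε) := by gcongr
    nlinarith
  · have h3 : L * 1 * L ≤ L * (d * √d) * √ε := by gcongr
    nlinarith

end Constants

/-! ### Termination and error at termination -/

section Termination

variable {S Z A : Type*} [Fintype Z] [Fintype A] {F : Set (S → ℝ)} {L : ℝ} {n : ℕ}
  {D : Fin n → (S × A) × S} {Φ : Finset (S → A → (Z × A) → ℝ)} {ε lam ell : ℝ}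

lemma exists_stopsAt {φ : ℕ → S → A → (Z × A) → ℝ} {f : ℕ → S → ℝ} {m : ℕ}
    (h : ¬ ∀ t < m, Continues D Φ lam ell φ f t) :
    ∃ t < m, StopsAt D Φ lam ell φ f t := by
  classical
  have hex : ∃ t, ¬ Continues D Φ lam ell φ f t := by
    push Not at h
    obtain ⟨t, -, ht⟩ := h
    exact ⟨t, ht⟩
  obtain ⟨t, hc, hmin⟩ : ∃ t, ¬ Continues D Φ lam ell φ f t ∧
      ∀ s < t, Continues D Φ lam ell φ f s :=
    ⟨Nat.find hex, Nat.find_spec hex, fun s hs => not_not.1 (Nat.find_min hex hs)⟩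
  refine ⟨t, ?_, hmin, ?_⟩
  · by_contra! hm
    exact h fun s hs => hmin s (hs.trans_le hm)
  · simp only [Continues, not_forall, not_lt] at hc
    obtain ⟨s, hs, hle⟩ := hc
    -- `Continues` at `t` covers all earlier tests too; since `t` is minimal, the failing inequality
    -- must be the one at `t` itself.
    rcases hs.lt_or_eq with hs | rfl
    · exact absurd (hmin s hs s le_rfl) (not_lt.2 hle)
    · exact hle

lemma discriminatorObjective_le (hn : 0 < n) (hlam : 0 ≤ lam)
    {f : S → ℝ} (hf : ∀ s, |f s| ≤ L) {φ : S → A → (Z × A) → ℝ} (hφ : φ ∈ Φ) :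
    discriminatorObjective D Φ lam φ f ≤ L ^ 2 := by
  have : Nonempty Φ := ⟨⟨φ, hφ⟩⟩
  refine ciSup_le fun φ' => ?_
  have h1 := ciInf_le (bddBelow_ridgeLoss (D := D) hlam φ f) 0
  have h2 : 0 ≤ ⨅ w, ridgeLoss D lam φ'.1 w f := le_ciInf fun w => ridgeLoss_nonneg hlam _ _ _
  have h3 : ridgeLoss D lam φ 0 f ≤ L ^ 2 := by
    have hn' : (n : ℝ) ≠ 0 := by positivity
    calc ridgeLoss D lam φ 0 f = (n : ℝ)⁻¹ * ∑ i, f (D i).2 ^ 2 := by simp [ridgeLoss]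
      _ ≤ (n : ℝ)⁻¹ * ∑ _i : Fin n, L ^ 2 := by
          refine mul_le_mul_of_nonneg_left (Finset.sum_le_sum fun i _ => ?_) (by positivity)
          exact sq_le_sq.2 ((hf _).trans (le_abs_self L))
      _ = L ^ 2 := by simp [hn']
  linarith

/-- In this regime `ε` is so large that the threshold is above `L ^ 2`, the largest value the
objective can take. -/
lemma not_continues_of_iterationBound_lt_one (hn : 0 < n)
    (hlam : 0 < lam) (hL : 0 < L) (hε : 0 < ε) {d : ℕ} (hd : 0 < d)
    (hT : iterationBound L d ε < 1) {φ : ℕ → S → A → (Z × A) → ℝ} {f : ℕ → S → ℝ}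
    (hφ : φ 0 ∈ Φ) (hf : ∀ s, |f 0 s| ≤ L) :
    ¬ Continues D Φ lam (threshold L lam n d ε) φ f 0 := by
  intro h
  have h1 := (h 0 le_rfl).trans_le (discriminatorObjective_le hn hlam.le hf hφ)
  have hd' : (1 : ℝ) ≤ d := by exact_mod_cast hd
  have hT0 : 0 ≤ iterationBound L d ε := Real.sqrt_nonneg _
  have h2 := iterationBound_sq (d := d) hL hε
  have h3 : 0 ≤ 2 * lam * L ^ 2 * d / n := by positivity
  rw [threshold, epsOne_eq hL hε] at h1
  have h4 : L ^ 2 ≤ iterationBound L d ε * (2 * d * ε) := by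
    have h5 : iterationBound L d ε * iterationBound L d ε * (2 * ε) ≤
        iterationBound L d ε * d * (2 * ε) := by
      gcongr
      linarith
    nlinarith [sq_nonneg L]
  nlinarith [sq_nonneg L]

variable [MeasurableSpace S] [MeasurableSpace Z] [MeasurableSingletonClass Z] [Nonempty Z]
  [MeasurableSpace A] [MeasurableSingletonClass A] [Nonempty A]
  {P : Kernel (S × A) S} {ψ' : S → Z} {θ : (S → ℝ) → Z × A → ℝ} {ρ : Measure (S × A)}

/-- Every failed test adds a direction `θ (f s)` badly covered by its predecessors, and the
elliptical potential leaves too little room for `⌊T⌋` of them. -/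
lemma UniformlyConcentrated.not_forall_continues [IsProbabilityMeasure ρ]
    (hP : IsLatentMean P ψ' θ F L) (hU : UniformlyConcentrated D ρ P Φ ψ' θ F L (ε / 2))
    (hΦ : IsBlockFeatureClass Φ) (hreal : oneHot ψ' ∈ Φ) (hF : ∀ f ∈ F, ∀ s, |f s| ≤ L)
    (hn : 0 < n) (hlam : 0 < lam) (hL : 0 < L) (hε : 2 * lam * L ^ 2 / n ≤ ε)
    {d : ℕ} (hd : d = Fintype.card (Z × A)) (hT : 1 ≤ iterationBound L d ε)
    {φ : ℕ → S → A → (Z × A) → ℝ} {f : ℕ → S → ℝ}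
    (hE : IsExecution D Φ F lam (threshold L lam n d ε) φ f) :
    ¬ ∀ t < ⌊iterationBound L d ε⌋₊, Continues D Φ lam (threshold L lam n d ε) φ f t := by
  classical
  intro hC
  have hn' : (0 : ℝ) < n := by exact_mod_cast hn
  have hε0 : 0 < ε := lt_of_lt_of_le (by positivity) hε
  have hd0 : 0 < d := by rw [hd]; exact Fintype.card_pos
  have hd1 : (1 : ℝ) ≤ d := by exact_mod_cast hd0
  set T := iterationBound L d ε with hTdef
  set m := ⌊T⌋₊ with hm
  have hmT : (m : ℝ) ≤ T := Nat.floor_le (by linarith)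
  have hTm : T < m + 1 := Nat.lt_floor_add_one T
  have hm1 : (1 : ℝ) ≤ m := by exact_mod_cast Nat.floor_pos.2 hT
  have hφ : ∀ s < m, φ s ∈ Φ := by
    rintro (_ | s) hs
    · exact hE.init
    · exact (hE.feature s (hC s (by omega))).1
  have hf : ∀ s < m, f s ∈ F := fun s hs =>
    (hE.discriminator s fun r hr => hC r (hr.trans hs)).1
  have hb : 2 * (ε / 2) + 2 * (lam / n * (Fintype.card (Z × A) * L ^ 2)) ≤ 2 * d * ε := by
    rw [← hd]
    have : 2 * (lam / n * (d * L ^ 2)) = d * (2 * lam * L ^ 2 / n) := by ring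
    rw [this]
    nlinarith
  -- Arbitrary `w` must be allowed, because the combined predictor below need not be bounded by `L`;
  -- truncation reduces to the bounded case.
  have hlt : ∀ s < m, ∀ w : Z × A → ℝ, epsOne L d ε < predictionError ρ P (φ s) w (f s) := by
    intro s hs w
    have h1 := hU.lt_of_lt_discriminatorObjective hΦ hn hlam hL.le (hf s hs) (hF _ (hf s hs))
      (hφ s hs) (hC s hs s le_rfl) (w := fun j => clip L (w j)) fun j => abs_clip_le hL.le _
    obtain ⟨ψ, hψ, h2⟩ := hΦ _ (hφ s hs)
    rw [h2] at h1 ⊢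
    have h3 := hP.predictionError_clip_le (ρ := ρ) hψ w (hf s hs)
    rw [← hd, threshold] at h1
    have h4 : lam / n * (d * L ^ 2) ≤ 2 * lam * L ^ 2 * d / n := by
      have : 0 ≤ lam / n * (d * L ^ 2) := by positivity
      have h5 : 2 * lam * L ^ 2 * d / n = 2 * (lam / n * (d * L ^ 2)) := by ring
      linarith
    linarith
  have hsum : ∀ s < m, ∀ w : ℕ → Z × A → ℝ,
      (∀ i < s, IsRidgeSolution D lam (φ s) (f i) (w i)) →
      ∑ i ∈ Finset.range s, predictionError ρ P (φ s) (w i) (f i) ≤ s * (2 * d * ε) := by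
    rintro (_ | s) hs w hw
    · simp
    · refine (hU.sum_predictionError_le hΦ hreal hP.abs_le hn hlam hL.le (f := f)
        (fun i hi => hf i (by omega)) (fun i hi => hF _ (hf i (by omega))) (hφ _ hs)
        (hE.feature s (hC s (by omega))).2 fun i hi => hw i (by omega)).trans ?_
      gcongr
  have hκ : 0 < T * (2 * d * ε) := by positivity
  -- Past errors and the ridge term contribute at most `κ` each, so an inverse-Gram norm below `8`
  -- would give error at most `16 * κ = ε₁`.
  have hpot := elliptical_potential (L := L) hκ (a := 8) (by norm_num) (θ := fun s => θ (f s))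
    (m := m) (fun s hs => hP.abs_le _ (hf s hs)) (by
      intro s hs g hg
      obtain ⟨ψ, hψ, hφs⟩ := hΦ _ (hφ s hs)
      have hex : ∀ i, ∃ w, i < s → IsRidgeSolution D lam (φ s) (f i) w := by
        intro i
        by_cases hi : i < s
        · obtain ⟨w, hw⟩ := exists_isRidgeSolution (D := D) hlam.le hL.le ψ
            (hF _ (hf i (hi.trans hs)))
          exact ⟨w, fun _ => hφs ▸ hw⟩
        · exact ⟨0, fun h => absurd h hi⟩
      choose w hw using hex
      have h1 := hsum s hs w hw
      obtain ⟨h0, h2⟩ := hP.predictionError_combination_le (ρ := ρ) hψ hκ.le f w s g hg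
      have h3 := hlt s hs fun j => ∑ i ∈ Finset.range s, (θ (f i) ⬝ᵥ g) * w i j
      rw [hφs] at h1 h3
      rw [epsOne_eq hL hε0, ← hTdef] at h3
      have hsT : (s : ℝ) ≤ T := le_trans (by exact_mod_cast hs.le) hmT
      have h4 : s * (2 * d * ε) ≤ T * (2 * d * ε) := by gcongr
      have h5 := h3.trans_le (h2.trans (mul_le_mul_of_nonneg_left
        (add_le_add_left (h1.trans h4) _) h0))
      by_contra! hlt8
      have := mul_le_mul_of_nonneg_right hlt8.le (by positivity :
        0 ≤ T * (2 * d * ε) + T * (2 * d * ε))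
      linarith)
  have h1 : (1 : ℝ) + m * L ^ 2 / (T * (2 * d * ε)) ≤ 1 + L ^ 2 / (2 * d * ε) := by
    refine add_le_add le_rfl ?_
    rw [div_le_div_iff₀ hκ (by positivity)]
    have : m * (L ^ 2 * (2 * d * ε)) ≤ T * (L ^ 2 * (2 * d * ε)) := by gcongr
    linarith
  rw [← hd] at hpot
  have h2 : (1 + 8 : ℝ) ^ m ≤ Real.exp T :=
    hpot.trans ((pow_le_pow_left₀ (by positivity) h1 _).trans
      (one_add_pow_le_exp_iterationBound hL hε0 hd0))
  -- From `e² ≤ 9` one gets `2m ≤ T`, incompatible with `T < m + 1` and `m ≥ 1`.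
  have h3 : Real.exp (m * 2) ≤ (1 + 8 : ℝ) ^ m := by
    rw [Real.exp_nat_mul]
    gcongr
    have := Real.exp_one_lt_d9
    rw [show (2 : ℝ) = 1 + 1 by norm_num, Real.exp_add]
    nlinarith [Real.exp_pos 1]
  have h4 := Real.exp_le_exp.1 (h3.trans h2)
  linarith

lemma UniformlyConcentrated.predictionError_le_of_stopsAt [IsProbabilityMeasure ρ]
    (hP : IsLatentMean P ψ' θ F L) (hU : UniformlyConcentrated D ρ P Φ ψ' θ F L (ε / 2))
    (hΦ : IsBlockFeatureClass Φ) (hreal : oneHot ψ' ∈ Φ) (hF : ∀ f ∈ F, ∀ s, |f s| ≤ L)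
    (hn : 0 < n) (hlam : 0 < lam) (hL : 0 < L) (hε : 2 * lam * L ^ 2 / n ≤ ε)
    {d : ℕ} (hd : d = Fintype.card (Z × A))
    {φ : S → A → (Z × A) → ℝ} (hφ : φ ∈ Φ) {f : S → ℝ} (hf : f ∈ F)
    (hterm : discriminatorObjective D Φ lam φ f ≤ threshold L lam n d ε) {w : Z × A → ℝ}
    (hw : IsRidgeSolution D lam φ f w) :
    predictionError ρ P φ w f ≤ 75 * L * (d : ℝ) ^ (3 / 2 : ℝ) * √ε := by
  have hn' : (0 : ℝ) < n := by exact_mod_cast hn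
  have hε0 : 0 < ε := lt_of_lt_of_le (by positivity) hε
  have hd0 : 0 < d := by rw [hd]; exact Fintype.card_pos
  obtain ⟨ψ, hψ, rfl⟩ := hΦ φ hφ
  have hwL := hw.abs_le hn hlam hL.le (hF f hf)
  refine termination_error_le hL hε0 hd0 (hP.predictionError_le hψ hwL hf) ?_
  have h1 := (hU _ hφ w hwL f hf).1
  have h2 : (⨅ v, ridgeLoss D lam (oneHot ψ) v f) - ⨅ v, ridgeLoss D lam (oneHot ψ') v f ≤
      threshold L lam n d ε :=
    (le_ciSup (Set.finite_range fun φ' : Φ => (⨅ v, ridgeLoss D lam (oneHot ψ) v f) -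
      ⨅ v, ridgeLoss D lam φ'.1 v f).bddAbove ⟨_, hreal⟩).trans hterm
  rw [hw.iInf_eq hlam.le] at h2
  have h3 := ciInf_le (bddBelow_ridgeLoss (D := D) hlam.le (oneHot ψ') f) (θ f)
  have h4 := ridgeLoss_le_add (D := D) hlam.le (oneHot ψ') (hP.abs_le f hf) f
  have h5 := ridgeLoss_zero_le (D := D) hlam.le (oneHot ψ) w f
  rw [← hd] at h4
  rw [threshold] at h2
  have h6 : 2 * lam * L ^ 2 * d / n ≤ d * ε := by
    have : 2 * lam * L ^ 2 * d / n = d * (2 * lam * L ^ 2 / n) := by ring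
    rw [this]
    gcongr
  have h7 : 2 * (lam / n * (d * L ^ 2)) = 2 * lam * L ^ 2 * d / n := by ring
  linarith

lemma UniformlyConcentrated.exists_stopsAt [IsProbabilityMeasure ρ]
    (hP : IsLatentMean P ψ' θ F L) (hU : UniformlyConcentrated D ρ P Φ ψ' θ F L (ε / 2))
    (hΦ : IsBlockFeatureClass Φ) (hreal : oneHot ψ' ∈ Φ) (hF : ∀ f ∈ F, ∀ s, |f s| ≤ L)
    (hn : 0 < n) (hlam : 0 < lam) (hL : 0 < L) (hε : 2 * lam * L ^ 2 / n ≤ ε)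
    {d : ℕ} (hd : d = Fintype.card (Z × A))
    {φ : ℕ → S → A → (Z × A) → ℝ} {f : ℕ → S → ℝ}
    (hE : IsExecution D Φ F lam (threshold L lam n d ε) φ f) :
    ∃ t, StopsAt D Φ lam (threshold L lam n d ε) φ f t ∧
      ((t : ℝ) + 1 ≤ max 1 (iterationBound L d ε)) ∧
      ∀ g ∈ F, ∀ w, IsRidgeSolution D lam (φ t) g w →
        predictionError ρ P (φ t) w g ≤ 75 * L * (d : ℝ) ^ (3 / 2 : ℝ) * √ε := by
  have hn' : (0 : ℝ) < n := by exact_mod_cast hn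
  have hε0 : 0 < ε := lt_of_lt_of_le (by positivity) hε
  have hd0 : 0 < d := by rw [hd]; exact Fintype.card_pos
  obtain ⟨t, ht, hs⟩ : ∃ t : ℕ, ((t : ℝ) + 1 ≤ max 1 (iterationBound L d ε)) ∧
      StopsAt D Φ lam (threshold L lam n d ε) φ f t := by
    rcases lt_or_ge (iterationBound L d ε) 1 with hT | hT
    · obtain ⟨t, ht, hs⟩ := _root_.exists_stopsAt (m := 1) (D := D) (Φ := Φ) (lam := lam)
        (ell := threshold L lam n d ε) (φ := φ) (f := f) fun h =>
        not_continues_of_iterationBound_lt_one hn hlam hL hε0 hd0 hT hE.init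
          (hF _ (hE.discriminator 0 (by simp)).1) (h 0 one_pos)
      obtain rfl : t = 0 := by omega
      exact ⟨0, by simp, hs⟩
    · obtain ⟨t, ht, hs⟩ := _root_.exists_stopsAt
        (hU.not_forall_continues hP hΦ hreal hF hn hlam hL hε hd hT hE)
      refine ⟨t, le_max_of_le_right ?_, hs⟩
      exact le_trans (by exact_mod_cast ht) (Nat.floor_le (by linarith))
  refine ⟨t, hs, ht, fun g hg w hw => ?_⟩
  have hφ : φ t ∈ Φ := by
    rcases t with _ | t
    · exact hE.init
    · exact (hE.feature t (hs.1 t (by omega))).1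
  -- `f t` maximizes the objective over `F`, so the passed test bounds the objective of every `g ∈
  -- F`.
  exact hU.predictionError_le_of_stopsAt hP hΦ hreal hF hn hlam hL hε hd hφ hg
    (((hE.discriminator t hs.1).2 g hg).trans hs.2) hw

end Termination

/-! ### Moments of the excess loss -/

section ExcessLoss

variable {X S : Type*} [MeasurableSpace X] [MeasurableSpace S]

/-- The excess square loss of the predictor `u` of `f(s')` over the conditional mean. -/
def excessLoss (P : Kernel X S) (u : X → ℝ) (f : S → ℝ) (y : X × S) : ℝ :=
  (u y.1 - f y.2) ^ 2 - (∫ s', f s' ∂(P y.1) - f y.2) ^ 2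

/-- The squared distance of the predictor `u` to the conditional mean of `f(s')`. -/
def squaredBias (P : Kernel X S) (u : X → ℝ) (f : S → ℝ) (p : X) : ℝ :=
  (u p - ∫ s', f s' ∂(P p)) ^ 2

variable {P : Kernel X S} [IsMarkovKernel P] {u : X → ℝ} {f : S → ℝ} {L : ℝ}

lemma integrable_of_measurable_of_abs_le {f : S → ℝ} (hf : Measurable f) (hfL : ∀ s, |f s| ≤ L)
    (ν : Measure S) [IsFiniteMeasure ν] : Integrable f ν :=
  Integrable.of_bound hf.aestronglyMeasurable L (Filter.Eventually.of_forall hfL)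

lemma abs_integral_le_of_abs_le {f : S → ℝ} (hfL : ∀ s, |f s| ≤ L) (ν : Measure S)
    [IsProbabilityMeasure ν] : |∫ s, f s ∂ν| ≤ L := by
  have h : ∀ᵐ s ∂ν, ‖f s‖ ≤ L := Filter.Eventually.of_forall hfL
  simpa using norm_integral_le_of_norm_le_const h

omit [IsMarkovKernel P] in
lemma measurable_integral_kernel [IsSFiniteKernel P] (hf : Measurable f) :
    Measurable fun p => ∫ s', f s' ∂(P p) :=
  (hf.stronglyMeasurable.integral_kernel (κ := P)).measurable

lemma measurable_excessLoss (hu : Measurable u) (hf : Measurable f) :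
    Measurable (excessLoss P u f) := by
  have hP : Measurable fun y : X × S => ∫ s', f s' ∂(P y.1) :=
    (measurable_integral_kernel (P := P) hf).comp measurable_fst
  have hu' : Measurable fun y : X × S => u y.1 := hu.comp measurable_fst
  have hf' : Measurable fun y : X × S => f y.2 := hf.comp measurable_snd
  exact ((hu'.sub hf').pow_const 2).sub ((hP.sub hf').pow_const 2)

lemma measurable_squaredBias (hu : Measurable u) (hf : Measurable f) :
    Measurable (squaredBias P u f) := by
  have := measurable_integral_kernel (P := P) hf
  unfold squaredBias
  fun_prop

omit [IsMarkovKernel P] in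
lemma squaredBias_nonneg (p : X) : 0 ≤ squaredBias P u f p := sq_nonneg _

lemma squaredBias_le (hu : ∀ p, |u p| ≤ L) (hf : ∀ s, |f s| ≤ L) (p : X) :
    |squaredBias P u f p| ≤ 4 * L ^ 2 := by
  rw [abs_of_nonneg (squaredBias_nonneg p)]
  obtain ⟨h1, h2⟩ := abs_le.1 (hu p)
  obtain ⟨h3, h4⟩ := abs_le.1 (abs_integral_le_of_abs_le hf (P p))
  unfold squaredBias
  nlinarith

lemma abs_excessLoss_le (hu : ∀ p, |u p| ≤ L) (hf : ∀ s, |f s| ≤ L) (y : X × S) :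
    |excessLoss P u f y| ≤ 4 * L ^ 2 := by
  obtain ⟨h1, h2⟩ := abs_le.1 (hu y.1)
  obtain ⟨h3, h4⟩ := abs_le.1 (abs_integral_le_of_abs_le hf (P y.1))
  obtain ⟨h5, h6⟩ := abs_le.1 (hf y.2)
  have h7 : (u y.1 - f y.2) ^ 2 ≤ (2 * L) ^ 2 := sq_le_sq' (by linarith) (by linarith)
  have h8 : (∫ s', f s' ∂(P y.1) - f y.2) ^ 2 ≤ (2 * L) ^ 2 :=
    sq_le_sq' (by linarith) (by linarith)
  unfold excessLoss
  rw [abs_le]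
  constructor <;> nlinarith [sq_nonneg (u y.1 - f y.2), sq_nonneg (∫ s', f s' ∂(P y.1) - f y.2)]

/-- The difference of squares factors, and one factor is the bias. This self-bounding of the second
moment is what yields rate `1/n` in the concentration. -/
lemma excessLoss_sq_le (hu : ∀ p, |u p| ≤ L) (hf : ∀ s, |f s| ≤ L) (y : X × S) :
    excessLoss P u f y ^ 2 ≤ 16 * L ^ 2 * squaredBias P u f y.1 := by
  obtain ⟨h1, h2⟩ := abs_le.1 (hu y.1)
  obtain ⟨h3, h4⟩ := abs_le.1 (abs_integral_le_of_abs_le hf (P y.1))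
  obtain ⟨h5, h6⟩ := abs_le.1 (hf y.2)
  have h7 : (u y.1 + ∫ s', f s' ∂(P y.1) - 2 * f y.2) ^ 2 ≤ (4 * L) ^ 2 :=
    sq_le_sq' (by linarith) (by linarith)
  calc excessLoss P u f y ^ 2
      = (u y.1 + ∫ s', f s' ∂(P y.1) - 2 * f y.2) ^ 2 * squaredBias P u f y.1 := by
        unfold excessLoss squaredBias
        ring
    _ ≤ (4 * L) ^ 2 * squaredBias P u f y.1 := by
        gcongr
        exact squaredBias_nonneg _
    _ = _ := by ring

/-- Given the state and action, the cross term vanishes because `∫ f ∂P` is the conditional mean. -/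
lemma integral_excessLoss (hu : Measurable u) (huL : ∀ p, |u p| ≤ L) (hf : Measurable f)
    (hfL : ∀ s, |f s| ≤ L) (q : Measure X) [IsProbabilityMeasure q] :
    ∫ y, excessLoss P u f y ∂(q ⊗ₘ P) = ∫ p, squaredBias P u f p ∂q := by
  rw [Measure.integral_compProd (integrable_of_measurable_of_abs_le (measurable_excessLoss hu hf)
    (abs_excessLoss_le huL hfL) _)]
  refine integral_congr_ae (Filter.Eventually.of_forall fun p => ?_)
  have hi := integrable_of_measurable_of_abs_le hf hfL (P p)
  have h : ∀ s, excessLoss P u f (p, s) =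
      (u p ^ 2 - (∫ s', f s' ∂(P p)) ^ 2) + 2 * (∫ s', f s' ∂(P p) - u p) * f s := by
    intro s
    unfold excessLoss
    ring
  simp only [h]
  rw [integral_add (integrable_const _) (hi.const_mul _), integral_const_mul]
  simp only [integral_const, probReal_univ, smul_eq_mul, one_mul]
  unfold squaredBias
  ring

/-- The cubic Taylor remainder is at most `(2/9)|x|³ ≤ (2/45)x²`, and `1/2 + 2/45 = 49/90`. -/
lemma exp_le_one_add_add_sq {x : ℝ} (hx : |x| ≤ 1 / 5) :
    Real.exp x ≤ 1 + x + 49 / 90 * x ^ 2 := by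
  have h := (abs_le.1 (Real.exp_bound (x := x) (by linarith) (n := 3) (by norm_num))).2
  simp only [Finset.sum_range_succ, Finset.sum_range_zero, Nat.factorial, pow_succ,
    pow_zero, ← sq_abs x] at h
  have h2 : |x| * |x| * |x| ≤ 1 / 5 * (|x| * |x|) := by nlinarith [abs_nonneg x]
  have h3 : |x| * |x| = x * x := abs_mul_abs_self x
  norm_num at h
  nlinarith

/-- The moment generating function of the excess loss, with the variance bounded by the mean. -/
lemma lintegral_exp_excessLoss_le (hL : 0 < L) (hu : Measurable u) (huL : ∀ p, |u p| ≤ L)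
    (hf : Measurable f) (hfL : ∀ s, |f s| ≤ L) (q : Measure X) [IsProbabilityMeasure q] {t : ℝ}
    (ht : |t| = 1 / (20 * L ^ 2)) :
    ∫⁻ y, ENNReal.ofReal (Real.exp (t * excessLoss P u f y)) ∂(q ⊗ₘ P) ≤
      ENNReal.ofReal (Real.exp ((t + |t| / 2) * ∫ p, squaredBias P u f p ∂q)) := by
  have hX := integrable_of_measurable_of_abs_le (measurable_excessLoss (P := P) hu hf)
    (abs_excessLoss_le huL hfL) (q ⊗ₘ P)
  have hB := integrable_of_measurable_of_abs_le (measurable_squaredBias (P := P) hu hf)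
    (squaredBias_le huL hfL) q
  have hB' : Integrable (fun y : X × S => squaredBias P u f y.1) (q ⊗ₘ P) :=
    integrable_of_measurable_of_abs_le ((measurable_squaredBias hu hf).comp measurable_fst)
      (fun y => squaredBias_le huL hfL y.1) _
  have hpt : ∀ y, Real.exp (t * excessLoss P u f y) ≤
      1 + t * excessLoss P u f y + |t| / 2 * squaredBias P u f y.1 := by
    intro y
    have h1 : |t * excessLoss P u f y| ≤ 1 / 5 := by
      rw [abs_mul, ht]
      calc 1 / (20 * L ^ 2) * |excessLoss P u f y| ≤ 1 / (20 * L ^ 2) * (4 * L ^ 2) := by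
            gcongr
            exact abs_excessLoss_le huL hfL y
        _ = 1 / 5 := by field_simp; norm_num
    refine (exp_le_one_add_add_sq h1).trans ?_
    -- With `|t| = 1/(20L²)` the factor `16L²|t|` is `4/5`, and `49/90 * 4/5` stays below `1/2`.
    have h2 : (t * excessLoss P u f y) ^ 2 ≤ 4 / 5 * |t| * squaredBias P u f y.1 := by
      calc (t * excessLoss P u f y) ^ 2 = |t| * |t| * excessLoss P u f y ^ 2 := by
            rw [abs_mul_abs_self]; ring
        _ ≤ |t| * |t| * (16 * L ^ 2 * squaredBias P u f y.1) := by
            gcongr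
            exact excessLoss_sq_le huL hfL y
        _ = |t| * (1 / (20 * L ^ 2)) * (16 * L ^ 2 * squaredBias P u f y.1) := by rw [← ht]
        _ = _ := by field_simp; ring
    have h3 : 0 ≤ |t| * squaredBias P u f y.1 :=
      mul_nonneg (abs_nonneg t) (squaredBias_nonneg y.1)
    linarith
  have hint : Integrable (fun y => 1 + t * excessLoss P u f y + |t| / 2 * squaredBias P u f y.1)
      (q ⊗ₘ P) := ((integrable_const _).add (hX.const_mul _)).add (hB'.const_mul _)
  calc ∫⁻ y, ENNReal.ofReal (Real.exp (t * excessLoss P u f y)) ∂(q ⊗ₘ P)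
      ≤ ∫⁻ y, ENNReal.ofReal (1 + t * excessLoss P u f y + |t| / 2 * squaredBias P u f y.1)
          ∂(q ⊗ₘ P) := lintegral_mono fun y => ENNReal.ofReal_le_ofReal (hpt y)
    _ = ENNReal.ofReal (∫ y, (1 + t * excessLoss P u f y + |t| / 2 * squaredBias P u f y.1)
          ∂(q ⊗ₘ P)) := (ofReal_integral_eq_lintegral_ofReal hint
            (Filter.Eventually.of_forall fun y => (Real.exp_pos _).le.trans (hpt y))).symm
    _ ≤ _ := by
        refine ENNReal.ofReal_le_ofReal ?_
        have hint' : Integrable (fun y => 1 + t * excessLoss P u f y) (q ⊗ₘ P) :=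
          (integrable_const _).add (hX.const_mul _)
        rw [integral_add hint' (hB'.const_mul _), integral_add (integrable_const _) (hX.const_mul _), integral_const_mul,
          integral_const_mul, integral_excessLoss hu huL hf hfL, Measure.integral_compProd hB']
        simp only [integral_const, probReal_univ, smul_eq_mul, one_mul]
        refine le_trans (le_of_eq ?_) (Real.add_one_le_exp _)
        ring

end ExcessLoss

/-! ### Exponential supermartingale for adaptive data -/

section Supermartingale

variable {Ω : Type*} {mΩ : MeasurableSpace Ω} {μ : Measure Ω} {ℱ : Filtration ℕ mΩ}

/-- Testing against all nonnegative `ℱ i`-measurable `M` encodes `E[E i | ℱ i] ≤ 1`; taking `M` to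
be the partial product gives the induction. -/
lemma lintegral_prod_le_of_forall_lintegral_mul_le {E : ℕ → Ω → ℝ≥0∞}
    (hE : ∀ i, Measurable[ℱ (i + 1)] (E i))
    (h : ∀ i, ∀ M : Ω → ℝ≥0∞, Measurable[ℱ i] M → ∫⁻ ω, M ω * E i ω ∂μ ≤ ∫⁻ ω, M ω ∂μ) (k : ℕ) :
    ∫⁻ ω, ∏ i ∈ Finset.range k, E i ω ∂μ ≤ μ Set.univ := by
  have hm : ∀ k, Measurable[ℱ k] fun ω => ∏ i ∈ Finset.range k, E i ω := fun k =>
    Finset.measurable_prod _ fun i hi =>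
      (hE i).mono (ℱ.mono (Nat.succ_le_of_lt (Finset.mem_range.1 hi))) le_rfl
  induction k with
  | zero => simp
  | succ k ih =>
    simp only [Finset.prod_range_succ]
    exact (h k _ (hm k)).trans ih

variable {S A : Type*} [MeasurableSpace S] [MeasurableSpace A] {n : ℕ}
  {P : Kernel (S × A) S} {q : Fin n → Ω → Measure (S × A)} {x : Fin n → Ω → (S × A) × S}

lemma IsAdaptiveSample.measurable_x (hx : IsAdaptiveSample μ P ℱ q x) (i : Fin n) :
    Measurable (x i) := (hx.adapted i).mono (ℱ.le _) le_rfl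

lemma IsAdaptiveSample.measurable_compProd [IsSFiniteKernel P]
    (hx : IsAdaptiveSample μ P ℱ q x) (i : Fin n) :
    Measurable[ℱ (i : ℕ)] fun ω => q i ω ⊗ₘ P := by
  refine Measure.measurable_of_measurable_coe _ fun B hB => ?_
  have : ∀ ω, (q i ω ⊗ₘ P) B = ∫⁻ p, P p (Prod.mk p ⁻¹' B) ∂(q i ω) := fun ω => by
    have := hx.prob i ω
    exact Measure.compProd_apply hB
  simp only [this]
  exact (Measure.measurable_lintegral (Kernel.measurable_kernel_prodMk_left hB)).comp
    (hx.predictable i)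

/-- This is the conditional law in integrated form, extended from indicators of past events to
nonnegative past-measurable weights. -/
lemma IsAdaptiveSample.lintegral_mul [IsSFiniteKernel P] [IsFiniteMeasure μ]
    (hx : IsAdaptiveSample μ P ℱ q x) (i : Fin n) {M : Ω → ℝ≥0∞} (hM : Measurable[ℱ (i : ℕ)] M)
    {g : (S × A) × S → ℝ≥0∞} (hg : Measurable g) :
    ∫⁻ ω, M ω * g (x i ω) ∂μ = ∫⁻ ω, M ω * ∫⁻ y, g y ∂(q i ω ⊗ₘ P) ∂μ := by
  have hq : Measurable fun ω => q i ω ⊗ₘ P := (hx.measurable_compProd i).mono (ℱ.le _) le_rfl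
  have hgq : Measurable fun ω => ∫⁻ y, g y ∂(q i ω ⊗ₘ P) :=
    (Measure.measurable_lintegral hg).comp hq
  have hgx : Measurable fun ω => g (x i ω) := hg.comp (hx.measurable_x i)
  have hmul : ∀ M G : Ω → ℝ≥0∞, Measurable M → Measurable G → Measurable fun ω => M ω * G ω :=
    fun M G hM hG => hM.mul hG
  refine Measurable.ennreal_induction (mα := ℱ (i : ℕ)) (motive := fun M =>
    ∫⁻ ω, M ω * g (x i ω) ∂μ = ∫⁻ ω, M ω * ∫⁻ y, g y ∂(q i ω ⊗ₘ P) ∂μ) ?_ ?_ ?_ hM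
  · intro c E hE
    have hE' := ℱ.le _ E hE
    have hlaw : (μ.restrict E).map (x i) = (μ.restrict E).bind fun ω => q i ω ⊗ₘ P := by
      ext B hB
      rw [Measure.map_apply (hx.measurable_x i) hB,
        Measure.restrict_apply ((hx.measurable_x i) hB), Measure.bind_apply hB hq.aemeasurable,
        Set.inter_comm, hx.conditional_law i E hE B hB]
    have h1 : ∀ G : Ω → ℝ≥0∞, Measurable G →
        ∫⁻ ω, E.indicator (fun _ => c) ω * G ω ∂μ = c * ∫⁻ ω in E, G ω ∂μ := by
      intro G hG
      rw [← lintegral_const_mul _ hG, ← lintegral_indicator hE']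
      congr 1 with ω
      by_cases hω : ω ∈ E <;> simp [hω]
    rw [h1 _ hgx, h1 _ hgq, ← lintegral_map hg (hx.measurable_x i), hlaw,
      Measure.lintegral_bind hq.aemeasurable hg.aemeasurable]
  · intro M₁ M₂ _ h₁ _ ih₁ ih₂
    have h₁' : Measurable M₁ := h₁.mono (ℱ.le _) le_rfl
    simp only [Pi.add_apply, add_mul]
    rw [lintegral_add_left (hmul _ _ h₁' hgx), lintegral_add_left (hmul _ _ h₁' hgq), ih₁, ih₂]
  · intro Ms hMs hmono ih
    have hMs' : ∀ k, Measurable (Ms k) := fun k => (hMs k).mono (ℱ.le _) le_rfl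
    simp only [ENNReal.iSup_mul]
    rw [lintegral_iSup (fun k => hmul _ _ (hMs' k) hgx)
        fun a b hab ω => mul_le_mul_left (hmono hab ω) _,
      lintegral_iSup (fun k => hmul _ _ (hMs' k) hgq)
        fun a b hab ω => mul_le_mul_left (hmono hab ω) _]
    simp only [ih]

lemma IsAdaptiveSample.measurable_integral (hx : IsAdaptiveSample μ P ℱ q x) (i : Fin n)
    {g : S × A → ℝ} (hg : Measurable g) (hg0 : ∀ p, 0 ≤ g p) :
    Measurable[ℱ (i : ℕ)] fun ω => ∫ p, g p ∂(q i ω) := by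
  have : ∀ ω, ∫ p, g p ∂(q i ω) = (∫⁻ p, ENNReal.ofReal (g p) ∂(q i ω)).toReal := fun ω =>
    integral_eq_lintegral_of_nonneg_ae (Filter.Eventually.of_forall hg0) hg.aestronglyMeasurable
  simp only [this]
  exact ((Measure.measurable_lintegral hg.ennreal_ofReal).comp (hx.predictable i)).ennreal_toReal

variable [IsMarkovKernel P] {u : S × A → ℝ} {f : S → ℝ} {L t : ℝ}

/-- The subtracted compensator depends only on the past, so it joins the weight `M` and cancels the
conditional moment generating function. -/
lemma IsAdaptiveSample.lintegral_exp_sum_le [IsProbabilityMeasure μ]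
    (hx : IsAdaptiveSample μ P ℱ q x) (hL : 0 < L)
    (hu : Measurable u) (huL : ∀ p, |u p| ≤ L) (hf : Measurable f) (hfL : ∀ s, |f s| ≤ L)
    (ht : |t| = 1 / (20 * L ^ 2)) :
    ∫⁻ ω, ENNReal.ofReal (Real.exp (∑ i, (t * excessLoss P u f (x i ω) -
      (t + |t| / 2) * ∫ p, squaredBias P u f p ∂(q i ω)))) ∂μ ≤ 1 := by
  set Y : Fin n → Ω → ℝ := fun i ω => t * excessLoss P u f (x i ω) -
      (t + |t| / 2) * ∫ p, squaredBias P u f p ∂(q i ω) with hY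
  have hV : ∀ i : Fin n, Measurable[ℱ (i : ℕ)] fun ω => ∫ p, squaredBias P u f p ∂(q i ω) :=
    fun i => hx.measurable_integral i (measurable_squaredBias hu hf) squaredBias_nonneg
  have hg : Measurable fun y => ENNReal.ofReal (Real.exp (t * excessLoss P u f y)) :=
    ((measurable_excessLoss hu hf).const_mul t).exp.ennreal_ofReal
  have key := lintegral_prod_le_of_forall_lintegral_mul_le (μ := μ) (ℱ := ℱ)
    (E := fun i ω => if h : i < n then ENNReal.ofReal (Real.exp (Y ⟨i, h⟩ ω)) else 1) ?_ ?_ n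
  · refine le_trans (le_of_eq ?_) (key.trans_eq measure_univ)
    congr 1 with ω
    rw [Real.exp_sum, ENNReal.ofReal_prod_of_nonneg fun i _ => (Real.exp_pos _).le,
      Finset.prod_range]
    exact Finset.prod_congr rfl fun i _ => by simp [hY]
  · intro i
    by_cases h : i < n
    · simp only [h, dif_pos]
      have h1 : Measurable[ℱ (i + 1)] fun ω => excessLoss P u f (x ⟨i, h⟩ ω) :=
        (measurable_excessLoss hu hf).comp (hx.adapted ⟨i, h⟩)
      have h2 : Measurable[ℱ (i + 1)] fun ω => ∫ p, squaredBias P u f p ∂(q ⟨i, h⟩ ω) :=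
        (hV ⟨i, h⟩).mono (ℱ.mono (Nat.le_succ i)) le_rfl
      exact ((h1.const_mul t).sub (h2.const_mul _)).exp.ennreal_ofReal
    · simp only [h, dif_neg, not_false_eq_true]
      exact measurable_const
  · intro i M hM
    by_cases h : i < n
    · simp only [h, dif_pos]
      have h1 : ∀ ω, M ω * ENNReal.ofReal (Real.exp (Y ⟨i, h⟩ ω)) =
          (M ω * ENNReal.ofReal (Real.exp (-((t + |t| / 2) *
            ∫ p, squaredBias P u f p ∂(q ⟨i, h⟩ ω))))) *
            ENNReal.ofReal (Real.exp (t * excessLoss P u f (x ⟨i, h⟩ ω))) := by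
        intro ω
        rw [hY, mul_assoc, ← ENNReal.ofReal_mul (Real.exp_pos _).le, ← Real.exp_add]
        congr 3
        ring
      simp only [h1]
      have h2 : Measurable[ℱ i] fun ω => M ω * ENNReal.ofReal (Real.exp (-((t + |t| / 2) *
            ∫ p, squaredBias P u f p ∂(q ⟨i, h⟩ ω)))) :=
        hM.mul ((hV ⟨i, h⟩).const_mul _).neg.exp.ennreal_ofReal
      rw [hx.lintegral_mul ⟨i, h⟩ h2 hg]
      refine lintegral_mono fun ω => ?_
      have := hx.prob ⟨i, h⟩ ω
      calc _ ≤ (M ω * ENNReal.ofReal (Real.exp (-((t + |t| / 2) *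
            ∫ p, squaredBias P u f p ∂(q ⟨i, h⟩ ω))))) * ENNReal.ofReal (Real.exp
            ((t + |t| / 2) * ∫ p, squaredBias P u f p ∂(q ⟨i, h⟩ ω))) := by
              gcongr
              exact lintegral_exp_excessLoss_le hL hu huL hf hfL _ ht
        _ = M ω := by
              rw [mul_assoc, ← ENNReal.ofReal_mul (Real.exp_pos _).le, ← Real.exp_add]
              simp
    · simp [h]

lemma IsAdaptiveSample.measurable_sum (hx : IsAdaptiveSample μ P ℱ q x)
    (hu : Measurable u) (hf : Measurable f) (t : ℝ) :
    Measurable fun ω => ∑ i, (t * excessLoss P u f (x i ω) -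
      (t + |t| / 2) * ∫ p, squaredBias P u f p ∂(q i ω)) := by
  refine Finset.measurable_sum _ fun i _ => ?_
  refine (((measurable_excessLoss hu hf).comp (hx.measurable_x i)).const_mul t).sub
    (Measurable.const_mul ?_ _)
  exact (hx.measurable_integral i (measurable_squaredBias hu hf) squaredBias_nonneg).mono
    (ℱ.le _) le_rfl

lemma IsAdaptiveSample.measure_lt_sum_le [IsProbabilityMeasure μ]
    (hx : IsAdaptiveSample μ P ℱ q x) (hL : 0 < L)
    (hu : Measurable u) (huL : ∀ p, |u p| ≤ L) (hf : Measurable f) (hfL : ∀ s, |f s| ≤ L)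
    (ht : |t| = 1 / (20 * L ^ 2)) (Λ : ℝ) :
    μ {ω | Λ < ∑ i, (t * excessLoss P u f (x i ω) -
      (t + |t| / 2) * ∫ p, squaredBias P u f p ∂(q i ω))} ≤ ENNReal.ofReal (Real.exp (-Λ)) := by
  have h1 := mul_meas_ge_le_lintegral (μ := μ)
    (hx.measurable_sum hu hf t).exp.ennreal_ofReal (ENNReal.ofReal (Real.exp Λ))
  have h2 := h1.trans (hx.lintegral_exp_sum_le hL hu huL hf hfL ht)
  rw [Real.exp_neg, ENNReal.ofReal_inv_of_pos (Real.exp_pos _), ENNReal.le_inv_iff_mul_le, mul_comm]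
  refine le_trans ?_ h2
  gcongr with ω
  intro hω
  exact ENNReal.ofReal_le_ofReal (Real.exp_le_exp.2 (le_of_lt hω))

end Supermartingale

/-! ### Grids of weights -/

section Grid

/-- The `i`-th of `k` equally spaced points of `[-R, R]`. -/
def gridPoint (R : ℝ) (k : ℕ) (i : Fin k) : ℝ := -R + 2 * R / k * (i : ℕ)

lemma abs_gridPoint_le {R : ℝ} (hR : 0 ≤ R) {k : ℕ} (i : Fin k) : |gridPoint R k i| ≤ R := by
  have hk : (0 : ℝ) < k := by exact_mod_cast i.pos
  have hi : ((i : ℕ) : ℝ) ≤ k := by exact_mod_cast i.2.le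
  have h1 : 2 * R / k * (i : ℕ) ≤ 2 * R / k * k := by gcongr
  have h2 : 2 * R / k * k = 2 * R := by field_simp
  have h3 : 0 ≤ 2 * R / k * (i : ℕ) := by positivity
  rw [abs_le, gridPoint]
  constructor <;> linarith

lemma exists_gridPoint {R : ℝ} (hR : 0 < R) {k : ℕ} (hk : 0 < k) {x : ℝ} (hx : |x| ≤ R) :
    ∃ i : Fin k, |x - gridPoint R k i| ≤ 2 * R / k := by
  have hk' : (0 : ℝ) < k := by exact_mod_cast hk
  obtain ⟨h1, h2⟩ := abs_le.1 hx
  set δ := 2 * R / k with hδ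
  have hδ0 : 0 < δ := by positivity
  have hδk : δ * k = 2 * R := by rw [hδ]; field_simp
  set y := (x + R) / δ with hy
  have hyδ : δ * y = x + R := by rw [hy]; field_simp
  have hy0 : 0 ≤ y := div_nonneg (by linarith) hδ0.le
  have hyk : y ≤ k := by
    by_contra! h
    have := mul_lt_mul_of_pos_left h hδ0
    linarith
  obtain ⟨i, h3, h4⟩ : ∃ i : Fin k, ((i : ℕ) : ℝ) ≤ y ∧ y ≤ (i : ℕ) + 1 := by
    -- Rounding down fails only at the right endpoint, where `y = k`; the last grid point `k - 1`
    -- serves there.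
    by_cases h : ⌊y⌋₊ < k
    · exact ⟨⟨⌊y⌋₊, h⟩, Nat.floor_le hy0, (Nat.lt_floor_add_one y).le⟩
    · have h5 : (k : ℝ) ≤ y := (Nat.le_floor_iff hy0).1 (not_lt.1 h)
      have h6 : ((k - 1 : ℕ) : ℝ) = k - 1 := by
        rw [Nat.cast_sub hk, Nat.cast_one]
      exact ⟨⟨k - 1, by omega⟩, by simp only [h6]; linarith, by simp only [h6]; linarith⟩
  refine ⟨i, ?_⟩
  have h5 : x - gridPoint R k i = δ * (y - (i : ℕ)) := by
    rw [gridPoint, mul_sub, hyδ]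
    ring
  rw [h5, abs_of_nonneg (mul_nonneg hδ0.le (by linarith))]
  nlinarith

lemma exists_gridPoint_pi {ι : Type*} {R : ℝ} (hR : 0 < R) {k : ℕ} (hk : 0 < k) {w : ι → ℝ}
    (hw : ∀ j, |w j| ≤ R) : ∃ v : ι → Fin k, ∀ j, |w j - gridPoint R k (v j)| ≤ 2 * R / k := by
  choose v hv using fun j => exists_gridPoint hR hk (hw j)
  exact ⟨v, hv⟩

end Grid

/-! ### Stability under perturbation of predictor and target -/

section Perturbation

variable {X S : Type*} [MeasurableSpace X] [MeasurableSpace S] {P : Kernel X S} [IsMarkovKernel P]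
  {u u' : X → ℝ} {f f' : S → ℝ} {L γ : ℝ}

lemma abs_integral_sub_integral_le (hf : Measurable f) (hf' : Measurable f')
    (hfL : ∀ s, |f s| ≤ L) (hfL' : ∀ s, |f' s| ≤ L) (h : ∀ s, |f s - f' s| ≤ γ)
    (ν : Measure S) [IsProbabilityMeasure ν] : |∫ s, f s ∂ν - ∫ s, f' s ∂ν| ≤ γ := by
  rw [← integral_sub (integrable_of_measurable_of_abs_le hf hfL ν)
    (integrable_of_measurable_of_abs_le hf' hfL' ν)]
  exact abs_integral_le_of_abs_le h ν

lemma abs_sq_sub_sq_le {a b : ℝ} (ha : |a| ≤ 2 * L) (hb : |b| ≤ 2 * L) (h : |a - b| ≤ 2 * γ) :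
    |a ^ 2 - b ^ 2| ≤ 8 * L * γ := by
  have h1 : |a + b| ≤ 4 * L := (abs_add_le a b).trans (by linarith)
  calc |a ^ 2 - b ^ 2| = |a + b| * |a - b| := by rw [← abs_mul]; ring_nf
    _ ≤ 4 * L * (2 * γ) := by gcongr; exact (abs_nonneg _).trans h1
    _ = _ := by ring

lemma abs_sub_le_two_mul {a b : ℝ} (ha : |a| ≤ L) (hb : |b| ≤ L) : |a - b| ≤ 2 * L :=
  (abs_sub a b).trans (by linarith)

lemma abs_sub_sub_sub_le {a b a' b' : ℝ} (ha : |a - a'| ≤ γ) (hb : |b - b'| ≤ γ) :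
    |(a - b) - (a' - b')| ≤ 2 * γ := by
  rw [sub_sub_sub_comm]
  exact abs_sub_le_two_mul ha hb

lemma abs_excessLoss_sub_le (hf : Measurable f) (hf' : Measurable f')
    (hu : ∀ p, |u p| ≤ L) (hu' : ∀ p, |u' p| ≤ L) (hfL : ∀ s, |f s| ≤ L) (hfL' : ∀ s, |f' s| ≤ L)
    (huu : ∀ p, |u p - u' p| ≤ γ) (hff : ∀ s, |f s - f' s| ≤ γ) (y : X × S) :
    |excessLoss P u f y - excessLoss P u' f' y| ≤ 16 * L * γ := by
  have h1 := abs_sq_sub_sq_le (abs_sub_le_two_mul (hu y.1) (hfL y.2))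
    (abs_sub_le_two_mul (hu' y.1) (hfL' y.2)) (abs_sub_sub_sub_le (huu y.1) (hff y.2))
  have h2 := abs_sq_sub_sq_le
    (abs_sub_le_two_mul (abs_integral_le_of_abs_le hfL (P y.1)) (hfL y.2))
    (abs_sub_le_two_mul (abs_integral_le_of_abs_le hfL' (P y.1)) (hfL' y.2))
    (abs_sub_sub_sub_le (abs_integral_sub_integral_le hf hf' hfL hfL' hff (P y.1)) (hff y.2))
  unfold excessLoss
  rw [abs_le] at h1 h2 ⊢
  constructor <;> linarith

lemma abs_squaredBias_sub_le (hf : Measurable f) (hf' : Measurable f')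
    (hu : ∀ p, |u p| ≤ L) (hu' : ∀ p, |u' p| ≤ L) (hfL : ∀ s, |f s| ≤ L) (hfL' : ∀ s, |f' s| ≤ L)
    (huu : ∀ p, |u p - u' p| ≤ γ) (hff : ∀ s, |f s - f' s| ≤ γ) (p : X) :
    |squaredBias P u f p - squaredBias P u' f' p| ≤ 8 * L * γ :=
  abs_sq_sub_sq_le (abs_sub_le_two_mul (hu p) (abs_integral_le_of_abs_le hfL (P p)))
    (abs_sub_le_two_mul (hu' p) (abs_integral_le_of_abs_le hfL' (P p)))
    (abs_sub_sub_sub_le (huu p) (abs_integral_sub_integral_le hf hf' hfL hfL' hff (P p)))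

/-- The constant `28` is `16` from the excess loss plus `3/2 * 8` from the bias. -/
lemma sum_excessLoss_le_add {n : ℕ} (D : Fin n → X × S) (q : Fin n → Measure X)
    [∀ i, IsProbabilityMeasure (q i)]
    (hum : Measurable u) (hum' : Measurable u') (hf : Measurable f) (hf' : Measurable f')
    (hu : ∀ p, |u p| ≤ L) (hu' : ∀ p, |u' p| ≤ L) (hfL : ∀ s, |f s| ≤ L) (hfL' : ∀ s, |f' s| ≤ L)
    (huu : ∀ p, |u p - u' p| ≤ γ) (hff : ∀ s, |f s - f' s| ≤ γ) (t : ℝ) :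
    ∑ i, (t * excessLoss P u f (D i) - (t + |t| / 2) * ∫ p, squaredBias P u f p ∂(q i)) ≤
      ∑ i, (t * excessLoss P u' f' (D i) - (t + |t| / 2) * ∫ p, squaredBias P u' f' p ∂(q i)) +
        n * (28 * |t| * L * γ) := by
  have hn : n * (28 * |t| * L * γ) = ∑ _i : Fin n, 28 * |t| * L * γ := by simp
  rw [hn, ← Finset.sum_add_distrib]
  refine Finset.sum_le_sum fun i _ => ?_
  have h1 : |t * (excessLoss P u f (D i) - excessLoss P u' f' (D i))| ≤ |t| * (16 * L * γ) := by
    rw [abs_mul]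
    gcongr
    exact abs_excessLoss_sub_le hf hf' hu hu' hfL hfL' huu hff _
  have hb := abs_integral_sub_integral_le (ν := q i) (measurable_squaredBias hum hf)
    (measurable_squaredBias hum' hf') (squaredBias_le hu hfL) (squaredBias_le hu' hfL')
    (abs_squaredBias_sub_le (P := P) hf hf' hu hu' hfL hfL' huu hff)
  have h2 : |(t + |t| / 2) * (∫ p, squaredBias P u f p ∂(q i) -
      ∫ p, squaredBias P u' f' p ∂(q i))| ≤ 3 / 2 * |t| * (8 * L * γ) := by
    rw [abs_mul]
    gcongr
    refine (abs_add_le _ _).trans ?_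
    rw [abs_of_nonneg (by positivity : 0 ≤ |t| / 2)]
    linarith
  have h3 := (abs_le.1 h1).2
  have h4 := (abs_le.1 h2).1
  linarith

end Perturbation

/-! ### Extracting finite covers -/

section Covering

variable {S : Type*} {F : Set (S → ℝ)} {γ : ℝ} {N : ℕ}

lemma exists_cover_of_coveringNumber_le (h : coveringNumber F γ ≤ N) :
    ∃ C : Finset (S → ℝ), (∀ g ∈ C, g ∈ F) ∧ (∀ f ∈ F, ∃ g ∈ C, ∀ s, |f s - g s| ≤ γ) ∧
      C.card ≤ N := by
  unfold coveringNumber at h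
  rcases isEmpty_or_nonempty {C : Finset (S → ℝ) // (∀ g ∈ C, g ∈ F) ∧
    ∀ f ∈ F, ∃ g ∈ C, ∀ s, |f s - g s| ≤ γ} with hE | hE
  · rw [iInf_of_empty] at h
    exact absurd h (by simp)
  · obtain ⟨C, hC⟩ := ENat.exists_eq_iInf fun C : {C : Finset (S → ℝ) // (∀ g ∈ C, g ∈ F) ∧
      ∀ f ∈ F, ∃ g ∈ C, ∀ s, |f s - g s| ≤ γ} => (C.1.card : ℕ∞)
    rw [← hC] at h
    exact ⟨C.1, C.2.1, C.2.2, by exact_mod_cast h⟩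

end Covering

lemma IsBlockFeatureClass.exists_dotProduct_eq {S Z A : Type*} [MeasurableSpace S]
    [MeasurableSpace Z] [Fintype Z] [Fintype A] {Φ : Finset (S → A → (Z × A) → ℝ)}
    (hΦ : IsBlockFeatureClass Φ)
    {φ : S → A → (Z × A) → ℝ} (hφ : φ ∈ Φ) :
    ∃ ψ : S → Z, ∀ (w : Z × A → ℝ) s a, w ⬝ᵥ φ s a = w (ψ s, a) := by
  obtain ⟨ψ, hψ, rfl⟩ := hΦ φ hφ
  exact ⟨ψ, fun w s a => dotProduct_oneHot ψ w s a⟩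

/-! ### Uniform concentration on the sample -/

section Sample

lemma exp_neg_log_mul_le {a b δ : ℝ} (hab : a ≤ b) (hb : 0 < b) (hδ : 0 < δ) :
    a * Real.exp (-Real.log (b / δ)) ≤ δ := by
  rw [Real.exp_neg, Real.exp_log (by positivity), inv_div]
  calc a * (δ / b) ≤ b * (δ / b) := by gcongr
    _ = δ := by field_simp

variable {S Z A Ω : Type*} [MeasurableSpace S]
  [MeasurableSpace A] {P : Kernel (S × A) S} {n : ℕ} {q : Fin n → Ω → Measure (S × A)}
  {Φ : Finset (S → A → (Z × A) → ℝ)} {F : Set (S → ℝ)} {L : ℝ}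

lemma isProbabilityMeasure_dataDistribution (hn : 0 < n) (ω : Ω)
    [∀ i, IsProbabilityMeasure (q i ω)] : IsProbabilityMeasure (dataDistribution q ω) := by
  constructor
  have : (n : ℝ≥0∞) ≠ 0 := by exact_mod_cast hn.ne'
  simp [dataDistribution, ENNReal.inv_mul_cancel this]

lemma predictionError_dataDistribution {ι : Type*} [Fintype ι] {φ : S → A → ι → ℝ} {w : ι → ℝ} {f : S → ℝ}
    (ω : Ω) (h : ∀ i, Integrable (squaredBias P (fun p => w ⬝ᵥ φ p.1 p.2) f) (q i ω)) :
    predictionError (dataDistribution q ω) P φ w f =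
      (n : ℝ)⁻¹ * ∑ i, ∫ p, squaredBias P (fun p => w ⬝ᵥ φ p.1 p.2) f p ∂(q i ω) := by
  unfold predictionError dataDistribution
  rw [integral_smul_measure]
  change _ • ∫ p, squaredBias P (fun p => w ⬝ᵥ φ p.1 p.2) f p ∂(∑ i, q i ω) = _
  rw [integral_finsetSum_measure fun i _ => h i]
  simp

variable [MeasurableSpace Z] [Fintype Z] [Fintype A]

lemma IsLatentMean.ridgeLoss_sub_eq {ψ' : S → Z} {θ : (S → ℝ) → Z × A → ℝ}
    (hP : IsLatentMean P ψ' θ F L) (D : Fin n → (S × A) × S) (φ : S → A → (Z × A) → ℝ)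
    (w : Z × A → ℝ) (f : S → ℝ) :
    ridgeLoss D 0 φ w f - ridgeLoss D 0 (oneHot ψ') (θ f) f =
      (n : ℝ)⁻¹ * ∑ i, excessLoss P (fun p => w ⬝ᵥ φ p.1 p.2) f (D i) := by
  simp only [ridgeLoss, dotProduct_oneHot, excessLoss, hP.integral_eq, zero_div, zero_mul,
    add_zero, Finset.sum_sub_distrib, mul_sub]

variable [MeasurableSingletonClass Z] [MeasurableSingletonClass A]

lemma IsBlockFeatureClass.measurable_predictor (hΦ : IsBlockFeatureClass Φ)
    {φ : S → A → (Z × A) → ℝ} (hφ : φ ∈ Φ) (w : Z × A → ℝ) :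
    Measurable fun p : S × A => w ⬝ᵥ φ p.1 p.2 := by
  obtain ⟨ψ, hψ, rfl⟩ := hΦ φ hφ
  simp only [dotProduct_oneHot]
  exact (Measurable.of_discrete (f := w)).comp (measurable_latent hψ)

variable {mΩ : MeasurableSpace Ω} {μ : Measure Ω} [IsProbabilityMeasure μ] {ℱ : Filtration ℕ mΩ}
  {x : Fin n → Ω → (S × A) × S} [IsMarkovKernel P]

/-- Uniform Bernstein bound over a product grid of weights and a finite class of functions. -/
lemma IsAdaptiveSample.exists_event_forall_grid (hx : IsAdaptiveSample μ P ℱ q x) (hL : 0 < L)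
    (hΦ : IsBlockFeatureClass Φ) (C : Finset (S → ℝ)) (hC : ∀ g ∈ C, Measurable g ∧ ∀ s, |g s| ≤ L)
    (k : ℕ) {δ Λ : ℝ}
    (hΛ : (2 * k ^ Fintype.card (Z × A) * Φ.card * C.card : ℝ) * Real.exp (-Λ) ≤ δ) :
    ∃ G : Set Ω, MeasurableSet G ∧ 1 - δ ≤ μ.real G ∧ ∀ ω ∈ G, ∀ φ ∈ Φ,
      ∀ v : Z × A → Fin k, ∀ g ∈ C, ∀ t : ℝ, |t| = 1 / (20 * L ^ 2) →
        ∑ i, (t * excessLoss P (fun p => (fun j => gridPoint L k (v j)) ⬝ᵥ φ p.1 p.2) g (x i ω) -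
          (t + |t| / 2) * ∫ p, squaredBias P
            (fun p => (fun j => gridPoint L k (v j)) ⬝ᵥ φ p.1 p.2) g p ∂(q i ω)) ≤ Λ := by
  classical
  -- Both signs of `t` are needed, one for each side of the two-sided comparison.
  let τ : Bool → ℝ := fun b => if b then 1 / (20 * L ^ 2) else -(1 / (20 * L ^ 2))
  have hτ : ∀ b, |τ b| = 1 / (20 * L ^ 2) := by
    have : (0 : ℝ) ≤ 1 / (20 * L ^ 2) := by positivity
    rintro (_ | _)
    · simp only [τ, Bool.false_eq_true, if_false, abs_neg, abs_of_nonneg this]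
    · simp only [τ, if_true, abs_of_nonneg this]
  let Y : Φ × (Z × A → Fin k) × C × Bool → Ω → ℝ := fun I ω =>
    ∑ i, (τ I.2.2.2 * excessLoss P
      (fun p => (fun j => gridPoint L k (I.2.1 j)) ⬝ᵥ I.1.1 p.1 p.2) I.2.2.1.1 (x i ω) -
      (τ I.2.2.2 + |τ I.2.2.2| / 2) * ∫ p, squaredBias P
        (fun p => (fun j => gridPoint L k (I.2.1 j)) ⬝ᵥ I.1.1 p.1 p.2) I.2.2.1.1 p ∂(q i ω))
  have hmeas : ∀ I, Measurable (Y I) := fun I =>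
    hx.measurable_sum (hΦ.measurable_predictor I.1.2 _) (hC _ I.2.2.1.2).1 _
  have hle : ∀ I, μ {ω | Λ < Y I ω} ≤ ENNReal.ofReal (Real.exp (-Λ)) := by
    intro I
    refine hx.measure_lt_sum_le hL (hΦ.measurable_predictor I.1.2 _) (fun p => ?_)
      (hC _ I.2.2.1.2).1 (hC _ I.2.2.1.2).2 (hτ _) Λ
    obtain ⟨ψ, hψ⟩ := hΦ.exists_dotProduct_eq I.1.2
    rw [hψ]
    exact abs_gridPoint_le hL.le _
  have hms : MeasurableSet (⋃ I, {ω | Λ < Y I ω}) :=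
    MeasurableSet.iUnion fun I => measurableSet_lt measurable_const (hmeas I)
  refine ⟨(⋃ I, {ω | Λ < Y I ω})ᶜ, hms.compl, ?_, ?_⟩
  · rw [probReal_compl_eq_one_sub hms]
    have h1 : μ.real (⋃ I, {ω | Λ < Y I ω}) ≤ δ := by
      calc μ.real (⋃ I, {ω | Λ < Y I ω}) ≤ ∑ I, μ.real {ω | Λ < Y I ω} :=
            measureReal_iUnion_fintype_le _
        _ ≤ ∑ _I : Φ × (Z × A → Fin k) × C × Bool, Real.exp (-Λ) :=
            Finset.sum_le_sum fun I _ =>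
              ENNReal.toReal_le_of_le_ofReal (Real.exp_pos _).le (hle I)
        _ = (2 * k ^ Fintype.card (Z × A) * Φ.card * C.card : ℝ) * Real.exp (-Λ) := by
            simp
            ring
        _ ≤ δ := hΛ
    linarith
  · intro ω hω φ hφ v g hg t ht
    simp only [Set.mem_compl_iff, Set.mem_iUnion, Set.mem_ofPred_eq, not_exists, not_lt] at hω
    have : ∃ b, τ b = t := by
      rcases abs_choice t with h | h
      · exact ⟨true, by simp only [τ, if_true, ← ht, h]⟩
      · exact ⟨false, by simp only [τ, Bool.false_eq_true, if_false, ← ht, h, neg_neg]⟩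
    obtain ⟨b, rfl⟩ := this
    exact hω (⟨φ, hφ⟩, v, ⟨g, hg⟩, b)

theorem IsAdaptiveSample.exists_uniformlyConcentrated {ψ' : S → Z} {θ : (S → ℝ) → Z × A → ℝ}
    (hx : IsAdaptiveSample μ P ℱ q x) (hP : IsLatentMean P ψ' θ F L) (hn : 0 < n) (hL : 0 < L)
    (hΦ : IsBlockFeatureClass Φ) (hΦ0 : Φ.Nonempty) (hF0 : F.Nonempty)
    (hF : ∀ f ∈ F, Measurable f ∧ ∀ s, |f s| ≤ L) {N : ℕ}
    (hN : coveringNumber F (L / (2 * n)) ≤ N) {δ : ℝ} (hδ₀ : 0 < δ) (hδ₁ : δ < 1)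
    {d : ℕ} (hd : d = Fintype.card (Z × A)) (hd0 : 0 < d) {ε : ℝ}
    (hε : epsTilde L δ n d Φ.card N ≤ ε) :
    ∃ G : Set Ω, MeasurableSet G ∧ 1 - δ ≤ μ.real G ∧ ∀ ω ∈ G,
      UniformlyConcentrated (fun i => x i ω) (dataDistribution q ω) P Φ ψ' θ F L (ε / 2) := by
  have hn' : (1 : ℝ) ≤ n := by exact_mod_cast hn
  obtain ⟨C, hCF, hCcov, hCN⟩ := exists_cover_of_coveringNumber_le hN
  have hC0 : 0 < C.card := by
    obtain ⟨f, hf⟩ := hF0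
    obtain ⟨g, hg, -⟩ := hCcov f hf
    exact Finset.card_pos.2 ⟨g, hg⟩
  have hN1 : (1 : ℝ) ≤ N := by exact_mod_cast hC0.trans_le hCN
  have hΦ1 : (1 : ℝ) ≤ Φ.card := by exact_mod_cast hΦ0.card_pos
  have hgrid : (4 : ℝ) ≤ (4 * n) ^ d := by
    calc (4 : ℝ) ≤ 4 * n := by linarith
      _ ≤ (4 * n) ^ d := le_self_pow₀ (by linarith) hd0.ne'
  set Λ := Real.log (2 * (4 * n) ^ d * Φ.card * N / δ) with hΛdef
  have hΛ2 : 2 ≤ Λ := by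
    rw [hΛdef, Real.le_log_iff_exp_le (by positivity), le_div_iff₀ hδ₀]
    have h1 : Real.exp 2 ≤ 8 := by
      have := Real.exp_one_lt_d9
      rw [show (2 : ℝ) = 1 + 1 by norm_num, Real.exp_add]
      nlinarith [Real.exp_pos 1]
    have h2 : (8 : ℝ) * 1 * 1 ≤ 2 * (4 * n) ^ d * Φ.card * N := by
      gcongr
      linarith
    nlinarith [Real.exp_pos 2]
  obtain ⟨G, hG, hGδ, hGω⟩ := hx.exists_event_forall_grid hL hΦ C
    (fun g hg => hF g (hCF g hg)) (4 * n) (δ := δ) (Λ := Λ) (by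
      refine exp_neg_log_mul_le ?_ (by positivity) hδ₀
      rw [← hd]
      push_cast
      gcongr)
  refine ⟨G, hG, hGδ, fun ω hω φ hφ w hw f hf => ?_⟩
  have := fun i => hx.prob i ω
  obtain ⟨ψ, hψ⟩ := hΦ.exists_dotProduct_eq hφ
  obtain ⟨g, hg, hfg⟩ := hCcov f hf
  -- With `4 * n` points the grid spacing equals the covering radius `L / (2 * n)`, so weights and
  -- discriminators are perturbed equally.
  obtain ⟨v, hv⟩ := exists_gridPoint_pi hL (k := 4 * n) (by omega) hw
  have hγ : 2 * L / ((4 * n : ℕ) : ℝ) = L / (2 * n) := by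
    push_cast
    field_simp
    norm_num
  rw [hγ] at hv
  have hwL : ∀ p : S × A, |w ⬝ᵥ φ p.1 p.2| ≤ L := fun p => by rw [hψ]; exact hw _
  have key : ∀ t : ℝ, |t| = 1 / (20 * L ^ 2) →
      ∑ i, (t * excessLoss P (fun p => w ⬝ᵥ φ p.1 p.2) f (x i ω) -
        (t + |t| / 2) * ∫ p, squaredBias P (fun p => w ⬝ᵥ φ p.1 p.2) f p ∂(q i ω)) ≤
        Λ + 14 / 20 := by
    intro t ht
    have h1 := hGω ω hω φ hφ v g hg t ht
    have h2 := sum_excessLoss_le_add (P := P) (fun i => x i ω) (fun i => q i ω)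
      (hΦ.measurable_predictor hφ w)
      (hΦ.measurable_predictor hφ fun j => gridPoint L (4 * n) (v j)) (hF f hf).1
      (hF g (hCF g hg)).1 hwL (fun p => by rw [hψ]; exact abs_gridPoint_le hL.le _)
      (hF f hf).2 (hF g (hCF g hg)).2 (fun p => by rw [hψ, hψ]; exact hv _) hfg t
    have h3 : n * (28 * |t| * L * (L / (2 * n))) = 14 / 20 := by
      rw [ht]
      field_simp
      norm_num
    linarith
  have hint : ∀ i, Integrable (squaredBias P (fun p => w ⬝ᵥ φ p.1 p.2) f) (q i ω) := fun i =>
    integrable_of_measurable_of_abs_le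
      (measurable_squaredBias (hΦ.measurable_predictor hφ w) (hF f hf).1)
      (squaredBias_le hwL (hF f hf).2) _
  rw [hP.ridgeLoss_sub_eq, predictionError_dataDistribution ω hint]
  set a := ∑ i, excessLoss P (fun p => w ⬝ᵥ φ p.1 p.2) f (x i ω)
  set b := ∑ i, ∫ p, squaredBias P (fun p => w ⬝ᵥ φ p.1 p.2) f p ∂(q i ω)
  simp only [Finset.sum_sub_distrib, ← Finset.mul_sum] at key
  have hη : (0 : ℝ) ≤ 1 / (20 * L ^ 2) := by positivity
  have h1 := key (1 / (20 * L ^ 2)) (abs_of_nonneg hη)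
  have h2 := key (-(1 / (20 * L ^ 2))) (by rw [abs_neg, abs_of_nonneg hη])
  rw [abs_neg, abs_of_nonneg hη] at h2
  rw [abs_of_nonneg hη] at h1
  have hε2 : 28 * L ^ 2 * Λ / n ≤ ε / 2 := by
    have : epsTilde L δ n d Φ.card N = 2 * (28 * L ^ 2 * Λ / n) := by
      rw [epsTilde]
      ring
    linarith
  -- Discretization costs `14/20`. Since `Λ ≥ 2`, `20L²(Λ + 14/20) ≤ 27L²Λ`, which fits into the
  -- `28L²Λ` that `ε / 2` provides.
  have hscale : ∀ c : ℝ, 1 / (20 * L ^ 2) * c ≤ Λ + 14 / 20 → (n : ℝ)⁻¹ * c ≤ ε / 2 := by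
    intro c hc
    refine le_trans ?_ hε2
    have h3 : c ≤ 28 * L ^ 2 * Λ := by
      have h4 : c = 20 * L ^ 2 * (1 / (20 * L ^ 2) * c) := by field_simp
      have h5 : 20 * L ^ 2 * (1 / (20 * L ^ 2) * c) ≤ 20 * L ^ 2 * (Λ + 14 / 20) := by gcongr
      have h6 : L ^ 2 * 2 ≤ L ^ 2 * Λ := by gcongr
      rw [h4]
      exact h5.trans (by linarith [sq_nonneg L])
    rw [inv_mul_eq_div]
    gcongr
  constructor
  · have := hscale (1 / 2 * b - a) (by linarith)
    linarith
  · have := hscale (a - 3 / 2 * b) (by linarith)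
    linarith

theorem IsAdaptiveSample.repLearnGuarantee [Nonempty Z] [Nonempty A]
    {ψ' : S → Z} {θ : (S → ℝ) → Z × A → ℝ}
    (hx : IsAdaptiveSample μ P ℱ q x) (hP : IsLatentMean P ψ' θ F L) (hn : 0 < n) (hL : 0 < L)
    (hΦ : IsBlockFeatureClass Φ) (hreal : oneHot ψ' ∈ Φ) (hF0 : F.Nonempty)
    (hF : ∀ f ∈ F, Measurable f ∧ ∀ s, |f s| ≤ L) {N : ℕ}
    (hN : coveringNumber F (L / (2 * n)) ≤ N) {δ : ℝ} (hδ₀ : 0 < δ) (hδ₁ : δ < 1)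
    {lam : ℝ} (hlam : 0 < lam) {d : ℕ} (hd : d = Fintype.card (Z × A)) {ε : ℝ}
    (hε : epsTilde L δ n d Φ.card N ≤ ε) (hε' : 2 * lam * L ^ 2 / n ≤ ε) :
    RepLearnGuarantee μ P q x Φ F lam (threshold L lam n d ε) δ (iterationBound L d ε)
      (75 * L * (d : ℝ) ^ (3 / 2 : ℝ) * √ε) := by
  obtain ⟨G, hG, hGδ, hU⟩ := hx.exists_uniformlyConcentrated hP hn hL hΦ ⟨_, hreal⟩ hF0 hF hN
    hδ₀ hδ₁ hd (hd ▸ Fintype.card_pos) hε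
  refine ⟨G, hG, hGδ, fun ω hω φ f hE => ?_⟩
  have := fun i => hx.prob i ω
  have := isProbabilityMeasure_dataDistribution (q := q) hn ω
  exact (hU ω hω).exists_stopsAt hP hΦ hreal (fun f hf => (hF f hf).2) hn hlam hL hε' hd hE

end Sample

/-! ### Covering the class `F_h` -/

section DiscriminatorCover

/-- Cover centers must lie in `F` but grid functions need not. Replacing each useful `G i` by a
member of `F` near it doubles the radius. -/
lemma coveringNumber_le_card {S I : Type*} [Fintype I] {F : Set (S → ℝ)} {γ : ℝ} (G : I → S → ℝ)
    (h : ∀ f ∈ F, ∃ i, ∀ s, |f s - G i s| ≤ γ) :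
    coveringNumber F (2 * γ) ≤ Fintype.card I := by
  classical
  have hch : ∀ i, ∃ g : S → ℝ, (∃ f ∈ F, ∀ s, |f s - G i s| ≤ γ) →
      g ∈ F ∧ ∀ s, |g s - G i s| ≤ γ := by
    intro i
    by_cases hi : ∃ f ∈ F, ∀ s, |f s - G i s| ≤ γ
    · obtain ⟨f, hf⟩ := hi
      exact ⟨f, fun _ => hf⟩
    · exact ⟨0, fun h => absurd h hi⟩
  choose g hg using hch
  let C := (Finset.univ.filter fun i => ∃ f ∈ F, ∀ s, |f s - G i s| ≤ γ).image g
  have hC : (∀ g ∈ C, g ∈ F) ∧ ∀ f ∈ F, ∃ g ∈ C, ∀ s, |f s - g s| ≤ 2 * γ := by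
    constructor
    · intro f hf
      obtain ⟨i, hi, rfl⟩ := Finset.mem_image.1 hf
      exact (hg i (Finset.mem_filter.1 hi).2).1
    · intro f hf
      obtain ⟨i, hi⟩ := h f hf
      have hex : ∃ f ∈ F, ∀ s, |f s - G i s| ≤ γ := ⟨f, hf, hi⟩
      refine ⟨g i, Finset.mem_image_of_mem _ (by simpa using hex), fun s => ?_⟩
      have h1 := abs_le.1 (hi s)
      have h2 := abs_le.1 ((hg i hex).2 s)
      exact abs_le.2 ⟨by linarith, by linarith⟩
  refine (iInf_le (fun C : {C : Finset (S → ℝ) // (∀ g ∈ C, g ∈ F) ∧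
    ∀ f ∈ F, ∃ g ∈ C, ∀ s, |f s - g s| ≤ 2 * γ} => (C.1.card : ℕ∞)) ⟨C, hC⟩).trans ?_
  exact_mod_cast Finset.card_image_le.trans (Finset.card_filter_le _ _)

lemma abs_sup'_sub_sup'_le {A : Type*} [Fintype A] [Nonempty A] {f g : A → ℝ} {γ : ℝ}
    (h : ∀ a, |f a - g a| ≤ γ) :
    |Finset.univ.sup' Finset.univ_nonempty f - Finset.univ.sup' Finset.univ_nonempty g| ≤ γ := by
  have h1 : Finset.univ.sup' Finset.univ_nonempty f ≤
      Finset.univ.sup' Finset.univ_nonempty g + γ :=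
    Finset.sup'_le _ _ fun a ha => by
      have := Finset.le_sup' g ha
      linarith [(abs_le.1 (h a)).2]
  have h2 : Finset.univ.sup' Finset.univ_nonempty g ≤
      Finset.univ.sup' Finset.univ_nonempty f + γ :=
    Finset.sup'_le _ _ fun a ha => by
      have := Finset.le_sup' f ha
      linarith [(abs_le.1 (h a)).1]
  exact abs_le.2 ⟨by linarith, by linarith⟩

variable {S Z A : Type*} [MeasurableSpace S] [MeasurableSpace Z] [Fintype Z] [Fintype A]
  [Nonempty A] {Φ : Finset (S → A → (Z × A) → ℝ)}

/-- A bounded value-type discriminator has a representation with coefficients in `[-3, 3]`,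
whatever the bound on its weights. -/
lemma exists_bounded_coefficients_of_mem_discriminators₂ (hΦ : IsBlockFeatureClass Φ)
    {r : S → A → ℝ} (hr : ∀ s a, r s a ≤ 1) {H : ℕ} {c : ℝ} {f : S → ℝ}
    (hf : f ∈ discriminators₂ Φ r H c) (hf2 : ∀ s, |f s| ≤ 2) :
    ∃ φ ∈ Φ, ∃ y : Z × A → ℝ, (∀ j, |y j| ≤ 3) ∧ ∀ s, f s =
      Finset.univ.sup' Finset.univ_nonempty fun a => r s a / (2 * (H : ℝ) + 1) + y ⬝ᵥ φ s a := by
  obtain ⟨φ, hφ, w, w', -, hw', hfe⟩ := hf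
  obtain ⟨ψ, hψ⟩ := hΦ.exists_dotProduct_eq hφ
  have hH : (1 : ℝ) ≤ 2 * (H : ℝ) + 1 := by linarith [(Nat.cast_nonneg H : (0 : ℝ) ≤ H)]
  set y : Z × A → ℝ := fun j => min (w j) 2 / (2 * (H : ℝ) + 1) + w' j with hy
  have hy3 : ∀ j, y j ≤ 3 := by
    intro j
    have h1 : min (w j) 2 / (2 * (H : ℝ) + 1) ≤ 2 := by
      rw [div_le_iff₀ (by linarith)]
      linarith [min_le_right (w j) 2]
    have := (abs_le.1 (hw' j)).2
    simp only [hy]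
    linarith
  have hfs : ∀ s, f s = Finset.univ.sup' Finset.univ_nonempty fun a =>
      r s a / (2 * (H : ℝ) + 1) + y (ψ s, a) := by
    intro s
    rw [hfe]
    simp only [dotProduct_comm (φ s _) w', hψ, hy]
    congr 1 with a
    ring
  refine ⟨φ, hφ, fun j => max (y j) (-3), fun j =>
    abs_le.2 ⟨le_max_right _ _, max_le (hy3 j) (by norm_num)⟩, fun s => ?_⟩
  simp only [hψ]
  refine le_antisymm ?_ (Finset.sup'_le _ _ fun a ha => ?_)
  · rw [hfs s]
    refine Finset.sup'_mono_fun fun a _ => ?_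
    gcongr
    exact le_max_left _ _
  -- An action whose coefficient is raised to `-3` contributes at most `1 - 3 = -2 ≤ f s`, so the
  -- maximum does not change.
  · rcases le_total (y (ψ s, a)) (-3) with h | h
    · rw [max_eq_right h]
      have h1 : r s a / (2 * (H : ℝ) + 1) ≤ 1 := by
        rw [div_le_one (by linarith)]
        exact (hr s a).trans hH
      linarith [(abs_le.1 (hf2 s)).1]
    · rw [max_eq_left h, hfs s]
      exact Finset.le_sup' (fun a => r s a / (2 * (H : ℝ) + 1) + y (ψ s, a)) ha

lemma exists_grid_of_mem_discriminators₁ (hΦ : IsBlockFeatureClass Φ) {f : S → ℝ}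
    (hf : f ∈ discriminators₁ Φ) {k : ℕ} (hk : 0 < k) :
    ∃ φ ∈ Φ, ∃ φ' ∈ Φ, ∃ v v' : Z × A → Fin k, ∀ s, |f s - (Fintype.card A : ℝ)⁻¹ *
      ∑ a, ((fun j => gridPoint 1 k (v j)) ⬝ᵥ φ s a - (fun j => gridPoint 1 k (v' j)) ⬝ᵥ φ' s a)| ≤
      2 * (2 / k) := by
  obtain ⟨φ, hφ, φ', hφ', θ, θ', hθ, hθ', rfl⟩ := hf
  obtain ⟨ψ, hψ⟩ := hΦ.exists_dotProduct_eq hφ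
  obtain ⟨ψ', hψ'⟩ := hΦ.exists_dotProduct_eq hφ'
  obtain ⟨v, hv⟩ := exists_gridPoint_pi one_pos hk hθ
  obtain ⟨v', hv'⟩ := exists_gridPoint_pi one_pos hk hθ'
  rw [mul_one] at hv hv'
  refine ⟨φ, hφ, φ', hφ', v, v', fun s => ?_⟩
  have hA : (Fintype.card A : ℝ) ≠ 0 := by exact_mod_cast Fintype.card_ne_zero
  simp only [dotProduct_comm (φ s _) θ, dotProduct_comm (φ' s _) θ', hψ, hψ']
  rw [← mul_sub, ← Finset.sum_sub_distrib, abs_mul, abs_of_nonneg (by positivity)]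
  calc _ ≤ (Fintype.card A : ℝ)⁻¹ * ∑ _a : A, 2 * (2 / (k : ℝ)) := by
        gcongr
        refine (Finset.abs_sum_le_sum_abs _ _).trans (Finset.sum_le_sum fun a _ => ?_)
        exact abs_sub_sub_sub_le (hv _) (hv' _)
    _ = 2 * (2 / k) := by
        simp only [Finset.sum_const, Finset.card_univ, nsmul_eq_mul]
        field_simp

lemma exists_grid_of_mem_discriminators₂ (hΦ : IsBlockFeatureClass Φ)
    {r : S → A → ℝ} (hr : ∀ s a, r s a ≤ 1) {H : ℕ} {c : ℝ} {f : S → ℝ}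
    (hf : f ∈ discriminators₂ Φ r H c) (hf2 : ∀ s, |f s| ≤ 2) {k : ℕ} (hk : 0 < k) :
    ∃ φ ∈ Φ, ∃ v : Z × A → Fin k, ∀ s, |f s - Finset.univ.sup' Finset.univ_nonempty fun a =>
      r s a / (2 * (H : ℝ) + 1) + (fun j => gridPoint 3 k (v j)) ⬝ᵥ φ s a| ≤ 6 / k := by
  obtain ⟨φ, hφ, y, hy, hfs⟩ :=
    exists_bounded_coefficients_of_mem_discriminators₂ hΦ hr hf hf2
  obtain ⟨ψ, hψ⟩ := hΦ.exists_dotProduct_eq hφ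
  obtain ⟨v, hv⟩ := exists_gridPoint_pi (by norm_num : (0 : ℝ) < 3) hk hy
  rw [show (2 : ℝ) * 3 = 6 by norm_num] at hv
  refine ⟨φ, hφ, v, fun s => ?_⟩
  rw [hfs s]
  refine abs_sup'_sub_sup'_le fun a => ?_
  rw [add_sub_add_left_eq_sub, hψ, hψ]
  exact hv _

/-- Grid sizes `8n` and `12n` make both families accurate to `1/(2n)`; moving the centers into `F`
gives radius `1/n`. The weight bound `c` does not enter. -/
lemma coveringNumber_discriminators_le (hΦ : IsBlockFeatureClass Φ)
    {r : S → A → ℝ} (hr : ∀ s a, r s a ≤ 1) {H : ℕ} {c : ℝ}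
    {F : Set (S → ℝ)} (hF : F ⊆ discriminators₁ Φ ∪ discriminators₂ Φ r H c)
    (hF2 : ∀ f ∈ F, ∀ s, |f s| ≤ 2) {n : ℕ} (hn : 0 < n) {K : ℕ} (hK : Φ.card ≤ K) :
    coveringNumber F (1 / n) ≤
      (2 * K ^ 2 * (12 * n) ^ (2 * Fintype.card (Z × A)) : ℕ) := by
  classical
  have hn' : (0 : ℝ) < n := by exact_mod_cast hn
  let G : (Φ × Φ × (Z × A → Fin (8 * n)) × (Z × A → Fin (8 * n))) ⊕ (Φ × (Z × A → Fin (12 * n))) →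
      S → ℝ := Sum.elim
    (fun i s => (Fintype.card A : ℝ)⁻¹ *
      ∑ a, ((fun j => gridPoint 1 (8 * n) (i.2.2.1 j)) ⬝ᵥ i.1.1 s a -
        (fun j => gridPoint 1 (8 * n) (i.2.2.2 j)) ⬝ᵥ i.2.1.1 s a))
    (fun i s => Finset.univ.sup' Finset.univ_nonempty fun a =>
      r s a / (2 * (H : ℝ) + 1) + (fun j => gridPoint 3 (12 * n) (i.2 j)) ⬝ᵥ i.1.1 s a)
  have hcov := coveringNumber_le_card (F := F) (γ := 1 / (2 * n)) G (by
    intro f hf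
    rcases hF hf with h | h
    · obtain ⟨φ, hφ, φ', hφ', v, v', hv⟩ :=
        exists_grid_of_mem_discriminators₁ hΦ h (k := 8 * n) (by omega)
      refine ⟨Sum.inl (⟨φ, hφ⟩, ⟨φ', hφ'⟩, v, v'), fun s => (hv s).trans (le_of_eq ?_)⟩
      push_cast
      field_simp
      norm_num
    · obtain ⟨φ, hφ, v, hv⟩ := exists_grid_of_mem_discriminators₂ hΦ hr h (hF2 f hf)
        (k := 12 * n) (by omega)
      refine ⟨Sum.inr (⟨φ, hφ⟩, v), fun s => (hv s).trans (le_of_eq ?_)⟩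
      push_cast
      field_simp
      norm_num)
  rw [show 2 * (1 / (2 * (n : ℝ))) = 1 / n by field_simp] at hcov
  refine hcov.trans ?_
  norm_cast
  simp only [Fintype.card_sum, Fintype.card_prod, Fintype.card_coe, Fintype.card_fun,
    Fintype.card_fin]
  set d := Fintype.card Z * Fintype.card A
  have h1 : (8 * n) ^ d ≤ (12 * n) ^ d := by gcongr; norm_num
  have h2 : (12 * n) ^ d * 1 ≤ (12 * n) ^ d * (12 * n) ^ d := by
    gcongr
    exact Nat.one_le_pow _ _ (by omega)
  calc Φ.card * (Φ.card * ((8 * n) ^ d * (8 * n) ^ d)) + Φ.card * (12 * n) ^ d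
      ≤ K * (K * ((12 * n) ^ d * (12 * n) ^ d)) + (K * K) * ((12 * n) ^ d * (12 * n) ^ d) := by
        gcongr
        · exact hK.trans (Nat.le_mul_self K)
        · simpa using h2
    _ = 2 * K ^ 2 * (12 * n) ^ (2 * d) := by ring

end DiscriminatorCover

/-! ### Block MDP structure -/

section BlockMDP

variable {S Z A : Type*} [MeasurableSpace S] [MeasurableSpace Z] [MeasurableSpace A]

/-- The conditional mean of `f` at the next step, as a function of latent state and action. -/
def BlockMDP.latentMean (M : BlockMDP S Z A) (h : ℕ) (f : S → ℝ) (j : Z × A) : ℝ :=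
  ∫ s', f s' ∂((M.emit (h + 1)).comp (M.trans h) j)

instance BlockMDP.isMarkovKernel_transition (M : BlockMDP S Z A) (h : ℕ) :
    IsMarkovKernel (M.transition h) := by
  have := M.emit_markov (h + 1)
  have := M.trans_markov h
  unfold BlockMDP.transition
  infer_instance

lemma BlockMDP.isLatentMean (M : BlockMDP S Z A) (h : ℕ) {F : Set (S → ℝ)} {L : ℝ}
    (hF : ∀ f ∈ F, ∀ s, |f s| ≤ L) :
    IsLatentMean (M.transition h) (M.decoder h) (M.latentMean h) F L where
  measurable := M.decoder_measurable h
  integral_eq f p := by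
    have : M.transition h p = (M.emit (h + 1)).comp (M.trans h) (M.decoder h p.1, p.2) := by
      rw [BlockMDP.transition, Kernel.comp_apply, Kernel.comp_apply, Kernel.comap_apply]
    rw [this, BlockMDP.latentMean]
  abs_le f hf j := by
    have := M.emit_markov (h + 1)
    have := M.trans_markov h
    exact abs_integral_le_of_abs_le (hF f hf) _

/-- Within the horizon, apply the trajectory bound to the constant trajectory at `(s, a)` and drop
the other nonnegative rewards. -/
lemma BlockMDP.reward_le_one (M : BlockMDP S Z A) (h : ℕ) (s : S) (a : A) :
    M.reward h s a ≤ 1 := by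
  rcases lt_or_ge h M.horizon with hh | hh
  · exact (Finset.single_le_sum (f := fun h => M.reward h s a) (fun i _ => M.reward_nonneg i s a)
      (Finset.mem_range.2 hh)).trans (M.reward_sum_le_one (fun _ => s) fun _ => a)
  · rw [M.reward_eq_zero h s a hh]
    exact zero_le_one

lemma BlockMDP.measurable_of_mem_discriminators [MeasurableSingletonClass Z] [Fintype Z]
    [MeasurableSingletonClass A] [Fintype A] [Nonempty A] (M : BlockMDP S Z A)
    {Φ : ℕ → Finset (S → A → (Z × A) → ℝ)} {h : ℕ} (hΦ : IsBlockFeatureClass (Φ (h + 1))) {c : ℝ}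
    {f : S → ℝ} (hf : f ∈ M.discriminators Φ c h) : Measurable f := by
  have hm : ∀ φ ∈ Φ (h + 1), ∀ (w : Z × A → ℝ) (a : A), Measurable fun s => w ⬝ᵥ φ s a :=
    fun φ hφ w a => (hΦ.measurable_predictor hφ w).comp (measurable_id.prodMk measurable_const)
  rcases hf with ⟨φ, hφ, φ', hφ', θ, θ', -, -, rfl⟩ | ⟨φ, hφ, w, w', -, -, rfl⟩
  · refine (Finset.measurable_sum _ fun a _ => ?_).const_mul _
    simp only [dotProduct_comm (φ _ _) θ, dotProduct_comm (φ' _ _) θ']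
    exact (hm φ hφ θ a).sub (hm φ' hφ' θ' a)
  · have := Finset.measurable_sup' (s := (Finset.univ : Finset A)) Finset.univ_nonempty
      (f := fun a s => (M.reward (h + 1) s a + min (w ⬝ᵥ φ s a) 2) / (2 * (M.horizon : ℝ) + 1) +
        φ s a ⬝ᵥ w') fun a _ => by
        simp only [dotProduct_comm (φ _ _) w']
        exact (((M.reward_measurable (h + 1) a).add
          ((hm φ hφ w a).min measurable_const)).div_const _).add (hm φ hφ w' a)
    convert this using 1
    ext s
    rw [Finset.sup'_apply]

end BlockMDP

/-! ### Rates for `F_h` -/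

section Rates

/-- For `n ≥ 2` all numerical factors are absorbed into powers of `n`: `4 ≤ n²`, `4n ≤ n³`, `12n ≤
n⁵`. The total exponent `2 + 13d` is at most `15d`, and `56 * 2² * 15 = 3360`. -/
lemma epsTilde_two_le {δ : ℝ} (hδ₀ : 0 < δ) (hδ₁ : δ < 1) {n d k K : ℕ} (hn : 2 ≤ n) (hd : 0 < d)
    (hk : 0 < k) (hkK : k ≤ K) :
    epsTilde 2 δ n d k (2 * K ^ 2 * (12 * n) ^ (2 * d)) ≤
      3360 * d * Real.log (n * K / δ) / n := by
  have hn' : (2 : ℝ) ≤ n := by exact_mod_cast hn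
  have hk' : (1 : ℝ) ≤ k := by exact_mod_cast hk
  have hkK' : (k : ℝ) ≤ K := by exact_mod_cast hkK
  have hK1 : (1 : ℝ) ≤ K := hk'.trans hkK'
  have h4 : (4 : ℝ) ≤ n ^ 2 := by nlinarith
  have h4n : (4 : ℝ) * n ≤ n ^ 3 := by
    calc (4 : ℝ) * n ≤ n ^ 2 * n := by gcongr
      _ = n ^ 3 := by ring
  have h12n : (12 : ℝ) * n ≤ n ^ 5 := by
    calc (12 : ℝ) * n ≤ (4 * 4) * n := by gcongr; norm_num
      _ ≤ (n ^ 2 * n ^ 2) * n := by gcongr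
      _ = n ^ 5 := by ring
  have hdelta : 1 ≤ 1 / δ := by rw [le_div_iff₀ hδ₀]; linarith
  have hmain : 2 * (4 * (n : ℝ)) ^ d * k * ((2 * K ^ 2 * (12 * n) ^ (2 * d) : ℕ) : ℝ) / δ ≤
      (n * K / δ) ^ (15 * d) := by
    push_cast
    calc 2 * (4 * (n : ℝ)) ^ d * k * (2 * K ^ 2 * (12 * n) ^ (2 * d)) / δ
        = 4 * (4 * (n : ℝ)) ^ d * (12 * n) ^ (2 * d) * (k * K ^ 2) * (1 / δ) := by ring
      _ ≤ n ^ 2 * (n ^ 3) ^ d * (n ^ 5) ^ (2 * d) * (K * K ^ 2) * (1 / δ) := by gcongr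
      _ = n ^ (2 + 13 * d) * K ^ 3 * (1 / δ) := by ring
      _ ≤ n ^ (15 * d) * K ^ (15 * d) * (1 / δ) ^ (15 * d) := by
          gcongr
          · linarith
          · omega
          · omega
          · exact le_self_pow₀ hdelta (by omega)
      _ = (n * K / δ) ^ (15 * d) := by
          rw [← mul_pow, ← mul_pow]
          ring
  have hlog : Real.log (2 * (4 * (n : ℝ)) ^ d * k *
      ((2 * K ^ 2 * (12 * n) ^ (2 * d) : ℕ) : ℝ) / δ) ≤ 15 * d * Real.log (n * K / δ) := by
    have hpos : 0 < 2 * (4 * (n : ℝ)) ^ d * k *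
        ((2 * K ^ 2 * (12 * n) ^ (2 * d) : ℕ) : ℝ) / δ := by
      push_cast
      positivity
    refine (Real.log_le_log hpos hmain).trans_eq ?_
    rw [Real.log_pow]
    push_cast
    ring
  rw [epsTilde]
  refine div_le_div_of_nonneg_right ?_ (by positivity)
  linarith

lemma RepLearnGuarantee.mono {S A ι Ω : Type*} [Fintype ι] [MeasurableSpace S] [MeasurableSpace A]
    {mΩ : MeasurableSpace Ω} {μ : Measure Ω} {n : ℕ} {P : Kernel (S × A) S}
    {q : Fin n → Ω → Measure (S × A)} {x : Fin n → Ω → (S × A) × S}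
    {Φ : Finset (S → A → ι → ℝ)} {F : Set (S → ℝ)} {lam ell δ T ζ ζ' : ℝ}
    (h : RepLearnGuarantee μ P q x Φ F lam ell δ T ζ) (hζ : ζ ≤ ζ') :
    RepLearnGuarantee μ P q x Φ F lam ell δ T ζ' := by
  obtain ⟨G, hG, hGδ, hω⟩ := h
  refine ⟨G, hG, hGδ, fun ω hωG φ f hE => ?_⟩
  obtain ⟨t, hs, ht, he⟩ := hω ω hωG φ f hE
  exact ⟨t, hs, ht, fun g hg w hw => (he g hg w hw).trans hζ⟩

lemma error_rate_le {C ε ℓ : ℝ} {d n : ℕ} (hC : 0 ≤ C) (hε : ε ≤ C * d * ℓ / n) :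
    75 * 2 * (d : ℝ) ^ (3 / 2 : ℝ) * √ε ≤ 150 * √C * (d : ℝ) ^ 2 * √(ℓ / n) := by
  rw [rpow_three_halves_eq (by positivity)]
  have h1 : √ε ≤ √C * √d * √(ℓ / n) := by
    rw [← Real.sqrt_mul hC, ← Real.sqrt_mul (by positivity)]
    exact Real.sqrt_le_sqrt (hε.trans_eq (by ring))
  have h2 : √(d : ℝ) * √d = d := Real.mul_self_sqrt (by positivity)
  calc 75 * 2 * ((d : ℝ) * √d) * √ε ≤ 75 * 2 * ((d : ℝ) * √d) * (√C * √d * √(ℓ / n)) := by gcongr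
    _ = 150 * √C * d * (√d * √d) * √(ℓ / n) := by ring
    _ = _ := by rw [h2]; ring

end Rates

end

/-! ### Assembly -/

theorem lemma3 (c₀ : ℝ) (hc₀ : 0 < c₀) :
    ∃ C₁ : ℝ, 0 < C₁ ∧ ∃ C₂ : ℝ, 0 < C₂ ∧
    ∀ (S Z A Ω : Type*) [MeasurableSpace S]
      [MeasurableSpace Z] [MeasurableSingletonClass Z] [Fintype Z] [Nonempty Z]
      [MeasurableSpace A] [MeasurableSingletonClass A] [Fintype A] [Nonempty A]
      (mΩ : MeasurableSpace Ω) (μ : Measure Ω) [IsProbabilityMeasure μ]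
      (M : BlockMDP S Z A) (Φ : ℕ → Finset (S → A → (Z × A) → ℝ))
      (_hblock : ∀ h, IsBlockFeatureClass (Φ h))
      (_hreal : ∀ h < M.horizon, oneHot (M.decoder h) ∈ Φ h)
      (h : ℕ) (_hh : h < M.horizon)
      (n : ℕ) (_hn : 0 < n) (ℱ : Filtration ℕ mΩ)
      (q : Fin n → Ω → Measure (S × A)) (x : Fin n → Ω → (S × A) × S)
      (_hx : IsAdaptiveSample μ (M.transition h) ℱ q x)
      (δ : ℝ) (_hδ₀ : 0 < δ) (_hδ₁ : δ < 1) (lam : ℝ) (_hlam : 0 < lam)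
      (d : ℕ) (_hd : d = Fintype.card Z * Fintype.card A),
      -- arbitrary bounded discriminator classes
      (∀ (F : Set (S → ℝ)) (L : ℝ) (N : ℕ) (ε : ℝ), F.Nonempty → 0 < L →
        (∀ f ∈ F, Measurable f ∧ ∀ s, |f s| ≤ L) →
        coveringNumber F (L / (2 * n)) ≤ N →
        epsTilde L δ n d (Φ h).card N ≤ ε →
        2 * lam * L ^ 2 / n ≤ ε →
        RepLearnGuarantee μ (M.transition h) q x (Φ h) F lam (threshold L lam n d ε) δ
          (iterationBound L d ε) (75 * L * (d : ℝ) ^ (3 / 2 : ℝ) * √ε)) ∧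
      -- the class `F_h`
      (∀ (c : ℝ) (F : Set (S → ℝ)) (K : ℕ), 0 < c → F.Nonempty →
        F ⊆ M.discriminators Φ c h → (∀ f ∈ F, ∀ s, |f s| ≤ 2) →
        (Φ h).card ≤ K → (Φ (h + 1)).card ≤ K → 2 ≤ n →
        lam ≤ c₀ * d * Real.log (n * K / δ) →
        (∃ N : ℕ, coveringNumber F (2 / (2 * n)) ≤ N ∧
          epsTilde 2 δ n d (Φ h).card N ≤ C₁ * d * Real.log (n * K / δ) / n) ∧
        2 * lam * 2 ^ 2 / n ≤ C₁ * d * Real.log (n * K / δ) / n ∧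
        ∀ (N : ℕ) (ε : ℝ), coveringNumber F (2 / (2 * n)) ≤ N →
          epsTilde 2 δ n d (Φ h).card N ≤ ε →
          2 * lam * 2 ^ 2 / n ≤ ε →
          ε ≤ C₁ * d * Real.log (n * K / δ) / n →
          RepLearnGuarantee μ (M.transition h) q x (Φ h) F lam (threshold 2 lam n d ε) δ
            (iterationBound 2 d ε)
            (C₂ * (d : ℝ) ^ 2 * √(Real.log (n * K / δ) / n))) := by
  -- In `C₁`, `3360` pays for the covering term and `8 * c₀ = 2 * 2² * c₀` for the regularization
  -- condition. `C₂ = 75 * 2 * √C₁` comes from inserting `ε ≤ C₁ d log(nK/δ)/n` into the general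
  -- error bound.
  refine ⟨3360 + 8 * c₀, by positivity, 150 * √(3360 + 8 * c₀), by positivity, ?_⟩
  intro S Z A Ω _ _ _ _ _ _ _ _ _ mΩ μ _ M Φ hblock hreal h hh n hn ℱ q x hx δ hδ₀ hδ₁ lam hlam
    d hd
  have hd' : d = Fintype.card (Z × A) := by rw [hd, Fintype.card_prod]
  have hd0 : 0 < d := hd' ▸ Fintype.card_pos
  have hgen : ∀ (F : Set (S → ℝ)) (L : ℝ) (N : ℕ) (ε : ℝ), F.Nonempty → 0 < L →
      (∀ f ∈ F, Measurable f ∧ ∀ s, |f s| ≤ L) →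
      coveringNumber F (L / (2 * n)) ≤ N →
      epsTilde L δ n d (Φ h).card N ≤ ε →
      2 * lam * L ^ 2 / n ≤ ε →
      RepLearnGuarantee μ (M.transition h) q x (Φ h) F lam (threshold L lam n d ε) δ
        (iterationBound L d ε) (75 * L * (d : ℝ) ^ (3 / 2 : ℝ) * √ε) :=
    fun F L N ε hF0 hL hF hN hε hε' =>
      hx.repLearnGuarantee (M.isLatentMean h fun f hf => (hF f hf).2) hn hL (hblock h) (hreal h hh)
        hF0 hF hN hδ₀ hδ₁ hlam hd' hε hε'
  refine ⟨hgen, ?_⟩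
  intro c F K _ hF0 hFsub hF2 hK hK' hn2 hlam'
  have hk : 0 < (Φ h).card := Finset.card_pos.2 ⟨_, hreal h hh⟩
  have hlog : 0 ≤ Real.log (n * K / δ) := by
    refine Real.log_nonneg ?_
    have h1 : (1 : ℝ) ≤ n := by exact_mod_cast hn
    have h2 : (1 : ℝ) ≤ K := by exact_mod_cast hk.trans_le hK
    rw [le_div_iff₀ hδ₀]
    nlinarith
  refine ⟨⟨2 * K ^ 2 * (12 * n) ^ (2 * d), ?_, ?_⟩, ?_, fun N ε hN hε hε' hεC => ?_⟩
  · rw [show (2 : ℝ) / (2 * n) = 1 / n by field_simp, hd']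
    exact coveringNumber_discriminators_le (hblock (h + 1)) (fun s a => M.reward_le_one _ s a) hFsub hF2 hn hK'
  · refine (epsTilde_two_le hδ₀ hδ₁ hn2 hd0 hk hK).trans ?_
    gcongr
    linarith
  · have h3 : 0 ≤ d * Real.log (n * K / δ) := by positivity
    refine div_le_div_of_nonneg_right ?_ (by positivity)
    linarith
  · exact (hgen F 2 N ε hF0 two_pos (fun f hf =>
      ⟨M.measurable_of_mem_discriminators (hblock (h + 1)) (hFsub hf), hF2 f hf⟩) hN hε hε').mono
      (error_rate_le (by positivity) hεC)
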